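/- **Setting.** MLL formulas are built from the literals $p,p^\perp$ by $\otimes$ and $⅋$; an indexed formula is a pair $\langle A,i\rangle$ with $i\in\mathbb N$. Links are ID-links with conclusions $\langle p,i\rangle,\langle p^\perp,j\rangle$, and $\otimes$-links (resp. $⅋$-links) with left premise $\langle A,i\rangle$, right premise $\langle B,j\rangle$ and conclusion $\langle A\otimes B,k\rangle$ (resp. $\langle A⅋ B,k\rangle$). A *proof structure* $\Theta=\langle\mathbb F,\mathbb L\rangle$ consists of a finite set $\mathbb F$ of indexed formulas and a finite set $\mathbb L$ of links with premises and conclusions in $\mathbb F$ such that different elements of $\mathbb F$ have different indices, the two premises of a multiplicative link are different elements of $\mathbb F$, each element of $\mathbb F$ is a premise of at most one link, and each element of $\mathbb F$ is a conclusion of exactly one link. A conclusion of $\Theta$ is an element of $\mathbb F$ that is not a premise of any link. $\Theta$ is a *proof net* if it is sequentializable, where sequentializability is defined inductively: (1) $\mathbb L$ consists of a single ID-link; or (2) some $⅋$-link $L$ has a conclusion $A⅋ B$ that is a conclusion of $\Theta$, and $\langle \mathbb F\setminus\{A⅋ B\},\mathbb L\setminus\{L\}\rangle$ is sequentializable; or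 (3) some $\otimes$-link $L$ has a conclusion $A\otimes B$ that is a conclusion of $\Theta$, and $\mathbb F=\mathbb F_1\uplus\mathbb F_2\uplus\{A\otimes B\}$, $\mathbb L=\mathbb L_1\uplus\mathbb L_2\uplus\{L\}$, where $\langle\mathbb F_1,\mathbb L_1\rangle$ and $\langle\mathbb F_2,\mathbb L_2\rangle$ are sequentializable proof structures, the left premise of $L$ lies in $\mathbb F_1$ and the right premise in $\mathbb F_2$. $G(\Theta)$ is the edge-labelled directed graph whose vertices are (the indices of) the elements of $\mathbb F$, with one edge labelled $\mathbf{ID}$ from $p$ to $p^\perp$ for each ID-link, and, for each multiplicative link, an edge labelled $\mathbf L$ from the left premise to the conclusion and an edge labelled $\mathbf R$ from the right premise to the conclusion. $G^{\mathrm{strip}}(\Theta)$ is $G(\Theta)$ with each vertex labelled in addition by its literal $p$, $p^\perp$ or by the main connective $\otimes$, $⅋$ of its formula. A *PS-family* is an equivalence class of the relation "$G(\Theta_1)\simeq G(\Theta_2)$" on proof structures. Two proof structures are regarded as equal if $G^{\mathrm{strip}}(\Theta_1)\simeq G^{\mathrm{strip}}(\Theta_2)$. For $\Theta_1,\Theta_2$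 in a PS-family $\mathcal F$, $d_{\mathcal F}(\Theta_1,\Theta_2)$ is the minimum, over all isomorphisms $G(\Theta_1)\simeq G(\Theta_2)$, of the number of vertices of $G^{\mathrm{strip}}(\Theta_1)$ whose label differs from that of their image in $G^{\mathrm{strip}}(\Theta_2)$. **Corollary.** Let $\mathcal F$ be a PS-family that contains at least two different proof nets. Then $$d(\mathcal F):=\min\{d_{\mathcal F}(\Theta_1,\Theta_2)\mid \Theta_1,\Theta_2\in\mathcal F\text{ proof nets},\ \Theta_1\neq\Theta_2\}=2.$$ Consequently $\mathcal F$ is not one error-correcting, i.e. it is not the case that whenever $\Theta\in\mathcal F$ is at distance $1$ from a proof net $\Theta_1\in\mathcal F$, every proof net $\Theta_2\in\mathcal F$ with $\Theta_2\neq\Theta_1$ satisfies $d_{\mathcal F}(\Theta,\Theta_2)>1$. -/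

import Mathlib

/-! ### Multiplicative linear logic: formulas, links, proof structures, proof nets -/

namespace MLL

/-- Formulas of MLL over the single propositional variable `p`. -/
inductive Formula : Type
  | pos : Formula
  | neg : Formula
  | tensor : Formula → Formula → Formula
  | par : Formula → Formula → Formula
  deriving DecidableEq

/-- An indexed formula (formula occurrence) `⟨F, i⟩`. -/
abbrev Occ : Type := Formula × ℕ

/-- The two kinds of multiplicative links. -/
inductive Conn : Type
  | tensor : Conn
  | par : Conn
  deriving DecidableEq

/-- The formula `A ⊗ B` or `A ⅋ B`. -/
def Conn.formula : Conn → Formula → Formula → Formula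
  | .tensor => Formula.tensor
  | .par => Formula.par

/-- MLL links. `ident i j` is the ID-link with conclusions `⟨p, i⟩` and `⟨p^⊥, j⟩`;
`mult c X Y k` is the multiplicative link of kind `c` with left premise `X = ⟨A, i⟩`, right premise
`Y = ⟨B, j⟩` and conclusion `⟨A c B, k⟩`. -/
inductive Link : Type
  | ident : ℕ → ℕ → Link
  | mult : Conn → Occ → Occ → ℕ → Link
  deriving DecidableEq

/-- The conclusion `⟨A c B, k⟩` of a multiplicative link. -/
def multConcl (c : Conn) (X Y : Occ) (k : ℕ) : Occ := (c.formula X.1 Y.1, k)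

/-- The finite set of conclusions of a link. -/
def Link.conclusions : Link → Finset Occ
  | .ident i j => {(Formula.pos, i), (Formula.neg, j)}
  | .mult c X Y k => {multConcl c X Y k}

/-- The finite set of premises of a link. -/
def Link.premises : Link → Finset Occ
  | .ident _ _ => ∅
  | .mult _ X Y _ => {X, Y}

/-- MLL proof structures. -/
structure ProofStructure : Type where
  /-- the formula occurrences -/
  forms : Finset Occ
  /-- the link occurrences -/
  links : Finset Link
  premises_subset : ∀ L ∈ links, L.premises ⊆ forms
  conclusions_subset : ∀ L ∈ links, L.conclusions ⊆ forms
  /-- distinct elements have distinct indices -/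
  index_unique : ∀ X ∈ forms, ∀ Y ∈ forms, X.2 = Y.2 → X.1 = Y.1
  /-- an occurrence is a premise of at most one link -/
  premise_unique : ∀ X ∈ forms, ∀ L ∈ links, ∀ L' ∈ links,
    X ∈ L.premises → X ∈ L'.premises → L = L'
  /-- the left and the right premise of a link are different occurrences -/
  premises_ne : ∀ c X Y k, Link.mult c X Y k ∈ links → X ≠ Y
  /-- an occurrence is a conclusion of exactly one link -/
  conclusion_unique : ∀ X ∈ forms, ∃! L, L ∈ links ∧ X ∈ L.conclusions

namespace ProofStructure

/-- `X` is a conclusion of `Θ`: an occurrence in `Θ` that is not a premise of any link of `Θ`. -/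
def IsConclusion (Θ : ProofStructure) (X : Occ) : Prop :=
  X ∈ Θ.forms ∧ ∀ L ∈ Θ.links, X ∉ L.premises

/-- Sequentializable proof structures. -/
inductive Sequentializable : ProofStructure → Prop
  | ident (Θ : ProofStructure) (i j : ℕ) (hL : Θ.links = {Link.ident i j}) :
      Sequentializable Θ
  | par (Θ Θ₀ : ProofStructure) (X Y : Occ) (k : ℕ)
      (hL : Link.mult Conn.par X Y k ∈ Θ.links)
      (hc : Θ.IsConclusion (multConcl Conn.par X Y k))
      (hforms : Θ₀.forms = Θ.forms.erase (multConcl Conn.par X Y k))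
      (hlinks : Θ₀.links = Θ.links.erase (Link.mult Conn.par X Y k))
      (h₀ : Sequentializable Θ₀) :
      Sequentializable Θ
  | tensor (Θ Θ₁ Θ₂ : ProofStructure) (X Y : Occ) (k : ℕ)
      (hL : Link.mult Conn.tensor X Y k ∈ Θ.links)
      (hc : Θ.IsConclusion (multConcl Conn.tensor X Y k))
      (hX : X ∈ Θ₁.forms) (hY : Y ∈ Θ₂.forms)
      (hforms : Θ.forms = insert (multConcl Conn.tensor X Y k) (Θ₁.forms ∪ Θ₂.forms))
      (hforms_disj : Disjoint Θ₁.forms Θ₂.forms)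
      (hforms_notMem : multConcl Conn.tensor X Y k ∉ Θ₁.forms ∪ Θ₂.forms)
      (hlinks : Θ.links = insert (Link.mult Conn.tensor X Y k) (Θ₁.links ∪ Θ₂.links))
      (hlinks_disj : Disjoint Θ₁.links Θ₂.links)
      (hlinks_notMem : Link.mult Conn.tensor X Y k ∉ Θ₁.links ∪ Θ₂.links)
      (h₁ : Sequentializable Θ₁) (h₂ : Sequentializable Θ₂) :
      Sequentializable Θ

/-- MLL proof nets are the sequentializable proof structures. -/
def IsProofNet (Θ : ProofStructure) : Prop := Θ.Sequentializable

end ProofStructure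

/-! ### Labelled directed graphs -/

/-- Labelled directed graphs with edge labels in `B`. -/
structure LabelledGraph (B : Type) : Type 1 where
  V : Type
  E : Type
  src : E → V
  tgt : E → V
  edgeLabel : E → B

/-- Labelled directed graphs with vertex labels in `A` and edge labels in `B`. -/
structure VLabelledGraph (A B : Type) : Type 1 extends LabelledGraph B where
  vertexLabel : V → A

/-- Graph isomorphisms of edge-labelled directed graphs. -/
structure GraphIso {B : Type} (G₁ G₂ : LabelledGraph B) : Type where
  hV : G₁.V ≃ G₂.V
  hE : G₁.E ≃ G₂.E
  src_comm : ∀ e, hV (G₁.src e) = G₂.src (hE e)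
  tgt_comm : ∀ e, hV (G₁.tgt e) = G₂.tgt (hE e)
  edgeLabel_comm : ∀ e, G₁.edgeLabel e = G₂.edgeLabel (hE e)

/-- Graph isomorphisms of vertex- and edge-labelled directed graphs. -/
structure VGraphIso {A B : Type} (G₁ G₂ : VLabelledGraph A B) : Type
    extends GraphIso G₁.toLabelledGraph G₂.toLabelledGraph where
  vertexLabel_comm : ∀ v, G₁.vertexLabel v = G₂.vertexLabel (hV v)

/-- The identity isomorphism. -/
def GraphIso.refl {B : Type} (G : LabelledGraph B) : GraphIso G G :=
  ⟨Equiv.refl _, Equiv.refl _, fun _ => rfl, fun _ => rfl, fun _ => rfl⟩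

/-- The inverse isomorphism. -/
def GraphIso.symm {B : Type} {G₁ G₂ : LabelledGraph B} (h : GraphIso G₁ G₂) : GraphIso G₂ G₁ where
  hV := h.hV.symm
  hE := h.hE.symm
  src_comm e := by rw [Equiv.symm_apply_eq, h.src_comm, Equiv.apply_symm_apply]
  tgt_comm e := by rw [Equiv.symm_apply_eq, h.tgt_comm, Equiv.apply_symm_apply]
  edgeLabel_comm e := by rw [h.edgeLabel_comm, Equiv.apply_symm_apply]

/-- The composition of isomorphisms. -/
def GraphIso.trans {B : Type} {G₁ G₂ G₃ : LabelledGraph B}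
    (h : GraphIso G₁ G₂) (h' : GraphIso G₂ G₃) : GraphIso G₁ G₃ where
  hV := h.hV.trans h'.hV
  hE := h.hE.trans h'.hE
  src_comm e := by simp [h.src_comm, h'.src_comm]
  tgt_comm e := by simp [h.tgt_comm, h'.tgt_comm]
  edgeLabel_comm e := by simp [h.edgeLabel_comm, h'.edgeLabel_comm]

/-! ### The graphs induced by proof structures -/

/-- Vertex labels `p`, `p^⊥`, `⊗`, `⅋`. -/
inductive VLabel : Type
  | pos : VLabel
  | neg : VLabel
  | tensor : VLabel
  | par : VLabel
  deriving DecidableEq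

/-- Edge labels `L`, `R`, `ID`. -/
inductive ELabel : Type
  | left : ELabel
  | right : ELabel
  | ident : ELabel
  deriving DecidableEq

/-- The strip function: a literal is sent to itself, a compound formula to its main connective. -/
def strip : Formula → VLabel
  | .pos => .pos
  | .neg => .neg
  | .tensor _ _ => .tensor
  | .par _ _ => .par

/-- The edges (source, label, target) contributed by a link. An ID-link gives one edge, from its
positive to its negative conclusion; a multiplicative link gives one edge from each premise to the
conclusion. Neither the edges nor their labels depend on the kind of a multiplicative link. -/
def Link.edges : Link → Finset (Occ × ELabel × Occ)
  | .ident i j => {((Formula.pos, i), ELabel.ident, (Formula.neg, j))}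
  | .mult c X Y k =>
      {(X, ELabel.left, multConcl c X Y k), (Y, ELabel.right, multConcl c X Y k)}

theorem Link.edges_mem (L : Link) (e : Occ × ELabel × Occ) (he : e ∈ L.edges) :
    e.1 ∈ L.premises ∪ L.conclusions ∧ e.2.2 ∈ L.premises ∪ L.conclusions := by
  cases L with
  | ident i j =>
    simp only [Link.edges, Finset.mem_singleton] at he
    subst he
    simp [Link.premises, Link.conclusions]
  | mult c X Y k =>
    simp only [Link.edges, Finset.mem_insert, Finset.mem_singleton] at he
    rcases he with rfl | rfl <;> simp [Link.premises, Link.conclusions]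

namespace ProofStructure

theorem edge_mem_forms (Θ : ProofStructure) (e : Occ × ELabel × Occ)
    (he : ∃ L ∈ Θ.links, e ∈ L.edges) : e.1 ∈ Θ.forms ∧ e.2.2 ∈ Θ.forms := by
  obtain ⟨L, hL, heL⟩ := he
  have hsub : L.premises ∪ L.conclusions ⊆ Θ.forms :=
    Finset.union_subset (Θ.premises_subset L hL) (Θ.conclusions_subset L hL)
  exact ⟨hsub (L.edges_mem e heL).1, hsub (L.edges_mem e heL).2⟩

/-- The graph `G(Θ)`. Its vertices are the formula occurrences of `Θ` (equivalently, their indices,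
since different occurrences have different indices), its edges those contributed by the links. -/
def graph (Θ : ProofStructure) : LabelledGraph ELabel where
  V := {X : Occ // X ∈ Θ.forms}
  E := {e : Occ × ELabel × Occ // ∃ L ∈ Θ.links, e ∈ L.edges}
  src e := ⟨e.1.1, (Θ.edge_mem_forms e.1 e.2).1⟩
  tgt e := ⟨e.1.2.2, (Θ.edge_mem_forms e.1 e.2).2⟩
  edgeLabel e := e.1.2.1

/-- The graph `G^f(Θ)`: `G(Θ)` with the vertex `⟨A, i⟩` labelled by `f A`. -/
def vgraph (f : Formula → VLabel) (Θ : ProofStructure) : VLabelledGraph VLabel ELabel where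
  toLabelledGraph := Θ.graph
  vertexLabel X := f X.1.1

/-- `Θ₁ ∼ Θ₂`: the graphs `G(Θ₁)` and `G(Θ₂)` are isomorphic. -/
def Related (Θ₁ Θ₂ : ProofStructure) : Prop := Nonempty (GraphIso Θ₁.graph Θ₂.graph)

/-- The equality of proof structures up to the names of indices: the graphs of `Θ₁` and `Θ₂` with
vertices labelled by the strip function are isomorphic. -/
def Same (Θ₁ Θ₂ : ProofStructure) : Prop :=
  Nonempty (VGraphIso (Θ₁.vgraph strip) (Θ₂.vgraph strip))

/-- The equivalence relation `∼` on proof structures. -/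
def relatedSetoid : Setoid ProofStructure where
  r := Related
  iseqv :=
    ⟨fun _ => ⟨GraphIso.refl _⟩, fun ⟨h⟩ => ⟨h.symm⟩, fun ⟨h⟩ ⟨h'⟩ => ⟨h.trans h'⟩⟩

end ProofStructure

/-! ### PS-families and their metric -/

/-- A PS-family is an equivalence class of `∼`. -/
def IsPSFamily (F : Set ProofStructure) : Prop := F ∈ ProofStructure.relatedSetoid.classes

/-- The number of vertices whose label is changed by an isomorphism `G(Θ₁) ≃ G(Θ₂)`. -/
noncomputable def mismatches {Θ₁ Θ₂ : ProofStructure} (h : GraphIso Θ₁.graph Θ₂.graph) : ℕ :=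
  Set.ncard {v : (Θ₁.vgraph strip).V |
    (Θ₂.vgraph strip).vertexLabel (h.hV v) ≠ (Θ₁.vgraph strip).vertexLabel v}

/-- The distance between two members of the same PS-family: the least number of label changes over
all isomorphisms (a minimum over a nonempty set of naturals when `Θ₁ ∼ Θ₂`). -/
noncomputable def psDist (Θ₁ Θ₂ : ProofStructure) : ℕ :=
  sInf {n : ℕ | ∃ h : GraphIso Θ₁.graph Θ₂.graph, mismatches h = n}

/-- The set of the distances between two different MLL proof nets of `F`. -/
def netDistances (F : Set ProofStructure) : Set ℕ :=
  {n : ℕ | ∃ Θ₁ ∈ F, ∃ Θ₂ ∈ F,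
    Θ₁.IsProofNet ∧ Θ₂.IsProofNet ∧ ¬ Θ₁.Same Θ₂ ∧ psDist Θ₁ Θ₂ = n}

/-- One error-correcting: a member of the family at distance one from some proof net of the family
is at distance greater than one from every other proof net of the family. -/
def IsOneErrorCorrecting (F : Set ProofStructure) : Prop :=
  ∀ Θ ∈ F, ∀ Θ₁ ∈ F, Θ₁.IsProofNet → psDist Θ Θ₁ = 1 →
    ∀ Θ₂ ∈ F, Θ₂.IsProofNet → ¬ Θ₂.Same Θ₁ → 1 < psDist Θ Θ₂

end MLL

/-! Lower bound. Reading a sequentialization from the identities down, each ID-link starts one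
component, each ⊗ merges two components into one, and a ⅋ merges none. Hence the number of ⊗ in a
proof net is the number of ID-links minus one (`Seq.card_tensorNodes`), which depends on the graph
alone. Labels of literals are forced by the direction of the ID-edges, so an isomorphism between two
proof nets can never change exactly one label; changing none means that the nets are equal.
Different nets are therefore at distance at least two.

Upper bound. Without its connectives, a proof structure is a set of cells (its skeleton), which the
graph determines; the members of a PS-family correspond to the labellings of one skeleton by ⊗ and
⅋, and the proof nets to the sequentializable labellings `Seq`. The core is `Seq.chain`: any two
sequentializable labellings `σ`, `τ` of one skeleton are linked by sequentializable labellings in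
which neighbours differ at two nodes at most. The induction is on a sequentialization of `τ`. If its
last cell is a ⊗, this cell splits the skeleton, so it is a ⊗ for `σ` too and `σ` restricts to both
parts (`Seq.split`); the parts are treated one after the other. If its last cell is a ⅋ with
conclusion `c`, one step makes `c` a ⅋ in `σ` (`Seq.closeParAt`), after which `c` can be erased on
both sides (`Seq.erase_par`).

The exchange behind `Seq.closeParAt`: when taking off `c` disconnects the cells above a ⅋ at `c'`,
but this ⅋ reconnects them, then `c` was a ⊗; the cell of `c'` can take over as the ⊗ between the
two pieces, and `c` can become a ⅋ below it.

Along a chain between two different nets, some step joins two different nets. By the lower bound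
that step changes exactly two labels, so the minimum is two. Performing only one of its two changes
yields a structure that is within distance one of both nets, which refutes one error-correction. -/

namespace MLL

/-! ### Skeletons and their sequentializable labellings -/

/-- Links between vertices, without formulas. -/
inductive Cell (α : Type) : Type
  | ident : α → α → Cell α
  | mult : α → α → α → Cell α
  deriving DecidableEq

section Skeleton

variable {α : Type} [DecidableEq α]

/-- The premises of a cell. -/
def Cell.prems : Cell α → Finset α
  | .ident _ _ => ∅
  | .mult a b _ => {a, b}

/-- The vertices of a cell. -/
def Cell.verts : Cell α → Finset α
  | .ident a b => {a, b}
  | .mult a b c => {a, b, c}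

@[simp, grind =] theorem Cell.mem_prems_ident (a b x : α) : x ∈ (Cell.ident a b).prems ↔ False := by
  simp [Cell.prems]

@[simp, grind =] theorem Cell.mem_prems_mult (a b c x : α) :
    x ∈ (Cell.mult a b c).prems ↔ x = a ∨ x = b := by
  simp [Cell.prems]

@[simp, grind =] theorem Cell.mem_verts_ident (a b x : α) :
    x ∈ (Cell.ident a b).verts ↔ x = a ∨ x = b := by
  simp [Cell.verts]

@[simp, grind =] theorem Cell.mem_verts_mult (a b c x : α) :
    x ∈ (Cell.mult a b c).verts ↔ x = a ∨ x = b ∨ x = c := by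
  simp [Cell.verts]

theorem Cell.prems_subset_verts (L : Cell α) : L.prems ⊆ L.verts := by
  cases L <;> intro x <;> grind

theorem Cell.verts_nonempty (L : Cell α) : ∃ x, x ∈ L.verts := by
  cases L <;> simp

/-- The vertices of a skeleton, that is, of a finite set of cells. -/
def vertices (S : Finset (Cell α)) : Finset α := S.biUnion Cell.verts

@[grind =] theorem mem_vertices {S : Finset (Cell α)} {x : α} :
    x ∈ vertices S ↔ ∃ L ∈ S, x ∈ L.verts := by
  simp [vertices]

theorem vertices_union (S T : Finset (Cell α)) : vertices (S ∪ T) = vertices S ∪ vertices T := by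
  ext x; simp only [mem_vertices, Finset.mem_union]; grind

/-- No cell of the skeleton has the vertex `x` as a premise. -/
def IsTerminal (S : Finset (Cell α)) (x : α) : Prop := ∀ L ∈ S, x ∉ L.prems

/-- `x` is a conclusion of the skeleton. -/
def IsExit (S : Finset (Cell α)) (x : α) : Prop := x ∈ vertices S ∧ IsTerminal S x

/-- `a` and `b` are conclusions of different ones of the two skeletons. -/
def Joins (S T : Finset (Cell α)) (a b : α) : Prop :=
  IsExit S a ∧ IsExit T b ∨ IsExit T a ∧ IsExit S b

/-- Since `Joins` does not say which part holds the left premise, arguments about a ⊗ need to be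
given for one part only. -/
theorem Joins.swap {S T : Finset (Cell α)} {a b : α} (h : Joins S T a b) : Joins T S a b :=
  Or.symm h

/-- The skeleton `S` with the labelling `σ` of its multiplicative vertices is sequentializable. -/
inductive Seq (σ : α → Conn) : Finset (Cell α) → Prop
  | ident (a b : α) (hab : a ≠ b) : Seq σ {Cell.ident a b}
  | par (S : Finset (Cell α)) (a b c : α) (hS : Seq σ S) (ha : IsExit S a) (hb : IsExit S b)
      (hab : a ≠ b) (hc : c ∉ vertices S) (hσ : σ c = Conn.par) :
      Seq σ (insert (Cell.mult a b c) S)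
  | tensor (S T : Finset (Cell α)) (a b c : α) (hS : Seq σ S) (hT : Seq σ T)
      (hd : Disjoint (vertices S) (vertices T)) (hj : Joins S T a b)
      (hcS : c ∉ vertices S) (hcT : c ∉ vertices T) (hσ : σ c = Conn.tensor) :
      Seq σ (insert (Cell.mult a b c) (S ∪ T))

/-- Every colouring of the vertices that is constant on each cell is constant. -/
def Connected (S : Finset (Cell α)) : Prop :=
  ∀ f : α → Prop, (∀ L ∈ S, ∀ x ∈ L.verts, ∀ y ∈ L.verts, f x → f y) →
    ∀ x ∈ vertices S, ∀ y ∈ vertices S, f x → f y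

/-- `c` is the conclusion of a multiplicative cell of `S`. -/
def IsNode (S : Finset (Cell α)) (c : α) : Prop := ∃ a b, Cell.mult a b c ∈ S

theorem IsNode.mem_vertices {S : Finset (Cell α)} {c : α} (h : IsNode S c) : c ∈ vertices S := by
  obtain ⟨a, b, h⟩ := h
  exact MLL.mem_vertices.2 ⟨_, h, by simp⟩

/-- Sequentializability consults a labelling only at conclusions of multiplicative cells, so values
elsewhere may be arbitrary. -/
theorem Seq.congr {σ τ : α → Conn} {S : Finset (Cell α)} (h : Seq σ S)
    (hτ : ∀ c, IsNode S c → σ c = τ c) : Seq τ S := by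
  induction h with
  | ident a b hab => exact .ident a b hab
  | par S a b c hS ha hb hab hc hσ ih =>
    refine .par S a b c (ih fun d hd => hτ d ?_) ha hb hab hc ?_
    · obtain ⟨x, y, h⟩ := hd
      exact ⟨x, y, by simp [h]⟩
    · rw [← hτ c ⟨a, b, by simp⟩, hσ]
  | tensor S T a b c hS hT hd hj hcS hcT hσ ihS ihT =>
    refine .tensor S T a b c (ihS fun d hd => hτ d ?_) (ihT fun d hd => hτ d ?_) hd hj hcS hcT ?_
    · obtain ⟨x, y, h⟩ := hd
      exact ⟨x, y, by simp [h]⟩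
    · obtain ⟨x, y, h⟩ := hd
      exact ⟨x, y, by simp [h]⟩
    · rw [← hτ c ⟨a, b, by simp⟩, hσ]

theorem Seq.connected {σ : α → Conn} {S : Finset (Cell α)} (h : Seq σ S) : Connected S := by
  induction h with
  | ident a b hab =>
    intro f hf x hx y hy
    simp only [mem_vertices, Finset.mem_singleton, exists_eq_left] at hx hy
    exact hf _ (by simp) x hx y hy
  | par S a b c hS ha hb hab hc hσ ih =>
    intro f hf
    have h1 := ih f (fun L hL => hf L (by simp [hL]))
    have h2 := hf (Cell.mult a b c) (by simp)
    have ha := ha.1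
    grind
  | tensor S T a b c hS hT hd hj hcS hcT hσ ihS ihT =>
    intro f hf
    have h1 := ihS f (fun L hL => hf L (by simp [hL]))
    have h3 := ihT f (fun L hL => hf L (by simp [hL]))
    have h2 := hf (Cell.mult a b c) (by simp)
    rcases hj with ⟨⟨ha, -⟩, ⟨hb, -⟩⟩ | ⟨⟨ha, -⟩, ⟨hb, -⟩⟩ <;> grind

/-! ### Taking off terminal cells -/

theorem IsExit.insert {S : Finset (Cell α)} {x : α} (h : IsExit S x) {L : Cell α}
    (hL : x ∉ L.prems) : IsExit (insert L S) x := by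
  unfold IsExit IsTerminal at *; grind

theorem IsExit.union_left {S : Finset (Cell α)} {x : α} (h : IsExit S x) {T : Finset (Cell α)}
    (hT : x ∉ vertices T) : IsExit (S ∪ T) x := by
  unfold IsExit IsTerminal at *; grind [Cell.prems_subset_verts]

theorem IsTerminal.mono {S T : Finset (Cell α)} {x : α} (h : IsTerminal S x) (hT : T ⊆ S) :
    IsTerminal T x := fun L hL => h L (hT hL)

theorem vertices_mono {S T : Finset (Cell α)} (hT : T ⊆ S) : vertices T ⊆ vertices S :=
  Finset.biUnion_subset_biUnion_of_subset_left _ hT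

/-- A premise of a cell of `S` is not a conclusion of `S`, and by disjointness not a vertex of `T`;
the joining cell uses one conclusion of each. -/
theorem Joins.prem_notMem {S T : Finset (Cell α)} {a b c a' b' c' x : α} (hj : Joins S T a' b')
    (hd : Disjoint (vertices S) (vertices T)) (hv : Cell.mult a b c ∈ S) (hx : x = a ∨ x = b) :
    x ∉ (Cell.mult a' b' c').prems := by
  have hd' := Finset.disjoint_left.1 hd
  have : x ∈ vertices S := mem_vertices.2 ⟨_, hv, by grind⟩
  have : ¬ IsTerminal S x := fun h => h _ hv (by grind)
  unfold Joins IsExit at hj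
  grind

/-- A cell whose conclusion is terminal can be taken off: its conclusion becomes fresh and its
premises become conclusions. -/
theorem Seq.erase_terminal {σ : α → Conn} {S : Finset (Cell α)} (h : Seq σ S) {a b c : α}
    (hv : Cell.mult a b c ∈ S) (hc : IsTerminal S c) :
    c ∉ vertices (S.erase (Cell.mult a b c)) ∧ IsExit (S.erase (Cell.mult a b c)) a ∧
      IsExit (S.erase (Cell.mult a b c)) b ∧ a ≠ b := by
  induction h with
  | ident a b hab => simp at hv
  | par S a' b' c' hS ha hb hab hc' hσ ih =>
    by_cases hw : Cell.mult a b c = Cell.mult a' b' c'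
    · have : Cell.mult a' b' c' ∉ S := by grind
      rw [hw, Finset.erase_insert this]
      grind
    · have hvS : Cell.mult a b c ∈ S := by grind
      have := ih hvS (by unfold IsTerminal at *; grind)
      unfold IsExit IsTerminal at *
      grind
  | tensor S T a' b' c' hS hT hd hj hcS hcT hσ ihS ihT =>
    by_cases hw : Cell.mult a b c = Cell.mult a' b' c'
    · have hd' := Finset.disjoint_left.1 hd
      have : Cell.mult a' b' c' ∉ S ∪ T := by grind
      rw [hw, Finset.erase_insert this]
      unfold Joins IsExit IsTerminal at *
      grind [Cell.prems_subset_verts]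
    -- The parts are interchangeable: the case of a cell in the first part is proved once and
    -- applied to both orders.
    · have key : ∀ S T : Finset (Cell α), Disjoint (vertices S) (vertices T) → Joins S T a' b' →
          c' ∉ vertices S → IsTerminal (insert (Cell.mult a' b' c') (S ∪ T)) c →
          Cell.mult a b c ∈ S → (c ∉ vertices (S.erase (Cell.mult a b c)) ∧
            IsExit (S.erase (Cell.mult a b c)) a ∧
            IsExit (S.erase (Cell.mult a b c)) b ∧ a ≠ b) →
          c ∉ vertices ((insert (Cell.mult a' b' c') (S ∪ T)).erase (Cell.mult a b c)) ∧
            IsExit ((insert (Cell.mult a' b' c') (S ∪ T)).erase (Cell.mult a b c)) a ∧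
            IsExit ((insert (Cell.mult a' b' c') (S ∪ T)).erase (Cell.mult a b c)) b ∧ a ≠ b := by
        intro S T hd hj hcS hc hvS ⟨h1, h2, h3, h4⟩
        have hd' := Finset.disjoint_left.1 hd
        have hcv : c ∈ vertices S := mem_vertices.2 ⟨_, hvS, by simp⟩
        have hav : a ∈ vertices S := mem_vertices.2 ⟨_, hvS, by simp⟩
        have hbv : b ∈ vertices S := mem_vertices.2 ⟨_, hvS, by simp⟩
        have hvT : Cell.mult a b c ∉ T := fun h => hd' hcv (mem_vertices.2 ⟨_, h, by simp⟩)
        have e : (insert (Cell.mult a' b' c') (S ∪ T)).erase (Cell.mult a b c) =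
            insert (Cell.mult a' b' c') (S.erase (Cell.mult a b c) ∪ T) := by
          ext L; grind
        rw [e]
        refine ⟨?_, (h2.union_left (hd' hav)).insert (hj.prem_notMem hd hvS (.inl rfl)),
          (h3.union_left (hd' hbv)).insert (hj.prem_notMem hd hvS (.inr rfl)), h4⟩
        have := hc (Cell.mult a' b' c') (by simp)
        grind
      have hvS : Cell.mult a b c ∈ S ∨ Cell.mult a b c ∈ T := by grind
      rcases hvS with hvS | hvS
      · exact key S T hd hj hcS hc hvS (ihS hvS (hc.mono (by grind)))
      · rw [Finset.union_comm] at hc ⊢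
        exact key T S hd.symm hj.swap hcT hc hvS (ihT hvS (hc.mono (by grind)))

/-- A terminal `⅋` can be removed. -/
theorem Seq.erase_par {σ : α → Conn} {S : Finset (Cell α)} (h : Seq σ S) {a b c : α}
    (hv : Cell.mult a b c ∈ S) (hc : IsTerminal S c) (hσc : σ c = Conn.par) :
    Seq σ (S.erase (Cell.mult a b c)) := by
  induction h with
  | ident a b hab => simp at hv
  | par S a' b' c' hS ha hb hab hc' hσ ih =>
    by_cases hw : Cell.mult a b c = Cell.mult a' b' c'
    · have : Cell.mult a' b' c' ∉ S := by grind
      rwa [hw, Finset.erase_insert this]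
    · have hvS : Cell.mult a b c ∈ S := by grind
      have hcS : IsTerminal S c := hc.mono (by grind)
      rw [Finset.erase_insert_of_ne (Ne.symm hw)]
      have := hc (Cell.mult a' b' c') (by simp)
      -- As `c` is terminal, it is not a premise of the last cell, so the two cells can be taken off
      -- in either order.
      refine .par _ a' b' c' (ih hvS hcS) ?_ ?_ hab (by grind) hσ
      all_goals
        unfold IsExit IsTerminal at *
        grind
  | tensor S T a' b' c' hS hT hd hj hcS hcT hσ ihS ihT =>
    have key : ∀ S T : Finset (Cell α), Disjoint (vertices S) (vertices T) → Joins S T a' b' →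
        c' ∉ vertices S → c' ∉ vertices T → Seq σ T →
        IsTerminal (insert (Cell.mult a' b' c') (S ∪ T)) c →
        Cell.mult a b c ∈ S → Seq σ (S.erase (Cell.mult a b c)) →
        Seq σ ((insert (Cell.mult a' b' c') (S ∪ T)).erase (Cell.mult a b c)) := by
      intro S T hd hj hcS hcT hT hc hvS hS
      have hd' := Finset.disjoint_left.1 hd
      have hcv : c ∈ vertices S := mem_vertices.2 ⟨_, hvS, by simp⟩
      have hvT : Cell.mult a b c ∉ T := fun h => hd' hcv (mem_vertices.2 ⟨_, h, by simp⟩)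
      have e : (insert (Cell.mult a' b' c') (S ∪ T)).erase (Cell.mult a b c) =
          insert (Cell.mult a' b' c') (S.erase (Cell.mult a b c) ∪ T) := by
        ext L; grind
      rw [e]
      have hcw := hc (Cell.mult a' b' c') (by simp)
      have hsub := vertices_mono (Finset.erase_subset (Cell.mult a b c) S)
      refine .tensor _ _ a' b' c' hS hT (hd.mono_left hsub) ?_ (fun h => hcS (hsub h)) hcT hσ
      unfold Joins IsExit IsTerminal at *
      grind
    have hvS : Cell.mult a b c ∈ S ∨ Cell.mult a b c ∈ T := by grind
    rcases hvS with hvS | hvS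
    · exact key S T hd hj hcS hcT hT hc hvS (ihS hvS (hc.mono (by grind)))
    · rw [Finset.union_comm] at hc ⊢
      exact key T S hd.symm hj.swap hcT hcS hS hc hvS (ihT hvS (hc.mono (by grind)))

/-! ### Separations and splitting cells -/

theorem Connected.subset {T X Y : Finset (Cell α)} (hT : Connected T) (hTXY : T ⊆ X ∪ Y)
    (hd : Disjoint (vertices X) (vertices Y)) {x : α} (hxT : x ∈ vertices T)
    (hxX : x ∈ vertices X) : T ⊆ X := by
  intro L hL
  obtain ⟨y, hy⟩ := L.verts_nonempty
  have hd' := Finset.disjoint_left.1 hd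
  have := hT (fun z => z ∈ vertices X) (by grind) x hxT y (mem_vertices.2 ⟨L, hL, hy⟩) hxX
  grind

theorem IsExit.of_union {X Y : Finset (Cell α)} {x : α} (h : IsExit (X ∪ Y) x)
    (hx : x ∈ vertices X) : IsExit X x :=
  ⟨hx, h.2.mono Finset.subset_union_left⟩

/-- A non-constant colouring that is constant on cells sorts the cells by colour. -/
theorem exists_separation {R : Finset (Cell α)} (h : ¬ Connected R) :
    ∃ X Y, R = X ∪ Y ∧ Disjoint (vertices X) (vertices Y) ∧ X.Nonempty ∧ Y.Nonempty := by
  classical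
  unfold Connected at h
  push Not at h
  obtain ⟨f, hf, x, hx, y, hy, hfx, hfy⟩ := h
  refine ⟨R.filter (fun L => ∀ x ∈ L.verts, f x), R.filter (fun L => ∀ x ∈ L.verts, ¬ f x),
    ?_, ?_, ?_, ?_⟩
  · ext L; grind
  · rw [Finset.disjoint_left]; grind
  · obtain ⟨L, hL, hxL⟩ := mem_vertices.1 hx
    exact ⟨L, by grind⟩
  · obtain ⟨L, hL, hxL⟩ := mem_vertices.1 hy
    exact ⟨L, by grind⟩

/-- A cell connecting two separate parts has one premise in each of them. -/
theorem Connected.joins {X Y : Finset (Cell α)} {a b c : α}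
    (h : Connected (insert (Cell.mult a b c) (X ∪ Y)))
    (hd : Disjoint (vertices X) (vertices Y)) (hX : X.Nonempty) (hY : Y.Nonempty)
    (ha : IsExit (X ∪ Y) a) (hb : IsExit (X ∪ Y) b) (hc : c ∉ vertices (X ∪ Y)) :
    Joins X Y a b := by
  have hd' := Finset.disjoint_left.1 hd
  have ha' := ha.1
  have hb' := hb.1
  rw [vertices_union, Finset.mem_union] at ha' hb' hc
  obtain ⟨L, hL⟩ := hX
  obtain ⟨M, hM⟩ := hY
  obtain ⟨x, hx⟩ := L.verts_nonempty
  obtain ⟨y, hy⟩ := M.verts_nonempty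
  have hxX : x ∈ vertices X := mem_vertices.2 ⟨L, hL, hx⟩
  have hyY : y ∈ vertices Y := mem_vertices.2 ⟨M, hM, hy⟩
  by_cases haX : a ∈ vertices X
  · by_cases hbX : b ∈ vertices X
    -- With both premises in `X`, the vertices of `X` together with `c` form a colour class that
    -- misses the nonempty `Y`.
    · exfalso
      have := h (fun z => z ∈ vertices X ∨ z = c) (by grind) x
        (by grind) y (by grind)
      grind
    · exact .inl ⟨ha.of_union haX, (Finset.union_comm X Y ▸ hb).of_union (by tauto)⟩
  · by_cases hbX : b ∈ vertices X
    · exact .inr ⟨(Finset.union_comm X Y ▸ ha).of_union (by tauto), hb.of_union hbX⟩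
    · exfalso
      have := h (fun z => z ∈ vertices X) (by grind) x (by grind) y (by grind)
      grind

theorem not_connected_of_joins {X Y : Finset (Cell α)} {a b : α}
    (hd : Disjoint (vertices X) (vertices Y)) (hj : Joins X Y a b) : ¬ Connected (X ∪ Y) := by
  intro h
  have hd' := Finset.disjoint_left.1 hd
  have := h (fun z => z ∈ vertices X) (by grind)
  unfold Joins IsExit at hj
  grind

/-- Every splitting of `S` by a multiplicative cell is at a `⊗` between sequentializable parts. -/
def SplitsWell (σ : α → Conn) (S : Finset (Cell α)) : Prop :=
  ∀ (X Y : Finset (Cell α)) (a b c : α), S = insert (Cell.mult a b c) (X ∪ Y) →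
    Disjoint (vertices X) (vertices Y) → Joins X Y a b → c ∉ vertices X → c ∉ vertices Y →
    Seq σ X ∧ Seq σ Y ∧ σ c = Conn.tensor

theorem cell_notMem_of_disjoint {X Y : Finset (Cell α)} (hd : Disjoint (vertices X) (vertices Y))
    {L : Cell α} (hL : L ∈ X) : L ∉ Y := by
  intro h
  obtain ⟨x, hx⟩ := L.verts_nonempty
  exact Finset.disjoint_left.1 hd (mem_vertices.2 ⟨_, hL, hx⟩) (mem_vertices.2 ⟨_, h, hx⟩)

/-- The last ⅋ lies in `X`, away from the splitting cell. Taking it off leaves a splitting of `S`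
into the rest of `X` and `Y`, to which the induction hypothesis applies; the ⅋ is then put back on
the `X` side. -/
theorem SplitsWell.par_aux {σ : α → Conn} {S X Y : Finset (Cell α)} {a b c a' b' c' : α}
    (ih : SplitsWell σ S) (ha : IsExit S a') (hb : IsExit S b')
    (hab : a' ≠ b') (hc' : c' ∉ vertices S) (hσ : σ c' = Conn.par)
    (e : insert (Cell.mult a' b' c') S = insert (Cell.mult a b c) (X ∪ Y))
    (hd : Disjoint (vertices X) (vertices Y)) (hj : Joins X Y a b) (hcX : c ∉ vertices X)
    (hcY : c ∉ vertices Y) (hw : Cell.mult a' b' c' ≠ Cell.mult a b c)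
    (hwX : Cell.mult a' b' c' ∈ X) : Seq σ X ∧ Seq σ Y ∧ σ c = Conn.tensor := by
  have hd' := Finset.disjoint_left.1 hd
  have hwS : Cell.mult a' b' c' ∉ S := by grind
  have hwY := cell_notMem_of_disjoint hd hwX
  have hsub := vertices_mono (Finset.erase_subset (Cell.mult a' b' c') X)
  have e' : S = insert (Cell.mult a b c) (X.erase (Cell.mult a' b' c') ∪ Y) := by
    ext L
    have := Finset.ext_iff.1 e L
    clear ih
    grind
  have hvS : Cell.mult a b c ∈ S := by rw [e']; simp
  have hpa := ha.2 _ hvS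
  have hpb := hb.2 _ hvS
  have hwa : a' ∈ vertices X := mem_vertices.2 ⟨_, hwX, by simp⟩
  have hwb : b' ∈ vertices X := mem_vertices.2 ⟨_, hwX, by simp⟩
  -- Only `c'` could disappear with the erased cell, and `c'` is not a vertex of `S`.
  have hX : ∀ x, IsExit X x → x ∈ vertices S → IsExit (X.erase (Cell.mult a' b' c')) x := by
    intro x hx hxS
    refine ⟨?_, hx.2.mono (Finset.erase_subset _ _)⟩
    have := hx.2 _ hwX
    obtain ⟨L, hL, hxL⟩ := mem_vertices.1 hx.1
    clear ih e e'
    grind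
  have haS : a ∈ vertices S := mem_vertices.2 ⟨_, hvS, by simp⟩
  have hbS : b ∈ vertices S := mem_vertices.2 ⟨_, hvS, by simp⟩
  obtain ⟨h1, h2, h3⟩ := ih _ _ _ _ _ e' (hd.mono_left hsub)
    (by
      rcases hj with ⟨h, h'⟩ | ⟨h, h'⟩
      · exact .inl ⟨hX _ h haS, h'⟩
      · exact .inr ⟨h, hX _ h' hbS⟩) (fun h => hcX (hsub h)) hcY
  refine ⟨?_, h2, h3⟩
  rw [← Finset.insert_erase hwX]
  have hXS : X.erase (Cell.mult a' b' c') ⊆ S := by rw [e']; grind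
  have hin : ∀ x, x ∈ vertices X → IsExit S x → IsExit (X.erase (Cell.mult a' b' c')) x := by
    intro x hx hxS
    refine ⟨?_, hxS.2.mono hXS⟩
    have := hxS.2 _ hvS
    obtain ⟨L, hL, hxL⟩ := mem_vertices.1 hxS.1
    rw [e'] at hL
    clear ih e e' hX
    grind
  exact .par _ a' b' c' h1 (hin _ hwa ha) (hin _ hwb hb) hab
    (fun h => hc' (vertices_mono hXS h)) hσ

/-- The last ⊗ lies in `X` and the splitting cell in `S`. The connected `T` avoids the splitting
cell and meets `X` in a premise of the last ⊗, so it lies inside `X`. Hence `S` splits into `X ∩ S`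
and `Y`, while `X` is the last ⊗ applied to `X ∩ S` and `T`. -/
theorem SplitsWell.tensor_aux {σ : α → Conn} {S T X Y : Finset (Cell α)} {a b c a' b' c' : α}
    (ih : SplitsWell σ S) (hdST : Disjoint (vertices S) (vertices T))
    (hjST : Joins S T a' b') (hcS : c' ∉ vertices S) (hcT : c' ∉ vertices T) (hT : Seq σ T)
    (hσ : σ c' = Conn.tensor)
    (e : insert (Cell.mult a' b' c') (S ∪ T) = insert (Cell.mult a b c) (X ∪ Y))
    (hd : Disjoint (vertices X) (vertices Y)) (hj : Joins X Y a b) (hcX : c ∉ vertices X)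
    (hcY : c ∉ vertices Y) (hvS : Cell.mult a b c ∈ S) (hwX : Cell.mult a' b' c' ∈ X) :
    Seq σ X ∧ Seq σ Y ∧ σ c = Conn.tensor := by
  have he : ∀ L, (L = Cell.mult a' b' c' ∨ L ∈ S ∨ L ∈ T) ↔
      (L = Cell.mult a b c ∨ L ∈ X ∨ L ∈ Y) := fun L => by
    simpa using Finset.ext_iff.1 e L
  have hvT := cell_notMem_of_disjoint hdST hvS
  have hwS : Cell.mult a' b' c' ∉ S := fun h => hcS (mem_vertices.2 ⟨_, h, by simp⟩)
  have hvX : Cell.mult a b c ∉ X := fun h => hcX (mem_vertices.2 ⟨_, h, by simp⟩)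
  have hvY : Cell.mult a b c ∉ Y := fun h => hcY (mem_vertices.2 ⟨_, h, by simp⟩)
  have hTX : T ⊆ X := by
    have hsub : T ⊆ X ∪ Y := by
      intro L hL
      have := he L
      rw [Finset.mem_union]
      by_cases h : L = Cell.mult a b c
      · exact absurd (h ▸ hL) hvT
      · tauto
    rcases hjST with ⟨-, ⟨h, -⟩⟩ | ⟨⟨h, -⟩, -⟩
    · exact hT.connected.subset hsub hd h (mem_vertices.2 ⟨_, hwX, by simp⟩)
    · exact hT.connected.subset hsub hd h (mem_vertices.2 ⟨_, hwX, by simp⟩)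
  have hXY : ∀ L ∈ X, L ∉ Y := fun L => cell_notMem_of_disjoint hd
  have hST : ∀ L ∈ S, L ∉ T := fun L => cell_notMem_of_disjoint hdST
  have eS : S = insert (Cell.mult a b c) (X ∩ S ∪ Y) := by
    ext L
    have := he L
    clear ih e
    grind
  have eX : X = insert (Cell.mult a' b' c') (X ∩ S ∪ T) := by
    ext L
    have := he L
    clear ih e eS
    grind
  have hsubX := vertices_mono (Finset.inter_subset_left (s₁ := X) (s₂ := S))
  have hsubS := vertices_mono (Finset.inter_subset_right (s₁ := X) (s₂ := S))
  have haS : a ∈ vertices S := mem_vertices.2 ⟨_, hvS, by simp⟩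
  have hbS : b ∈ vertices S := mem_vertices.2 ⟨_, hvS, by simp⟩
  have hwa : a' ∈ vertices X := mem_vertices.2 ⟨_, hwX, by simp⟩
  have hwb : b' ∈ vertices X := mem_vertices.2 ⟨_, hwX, by simp⟩
  have hd' := Finset.disjoint_left.1 hd
  have hdST' := Finset.disjoint_left.1 hdST
  have hX : ∀ x, IsExit X x → x ∈ vertices S → IsExit (X ∩ S) x := by
    intro x hx hxS
    refine ⟨?_, hx.2.mono Finset.inter_subset_left⟩
    have := hx.2 _ hwX
    obtain ⟨L, hL, hxL⟩ := mem_vertices.1 hx.1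
    rw [eX] at hL
    clear ih e eS eX he
    grind
  have hin : ∀ x, x ∈ vertices X → IsExit S x → IsExit (X ∩ S) x := by
    intro x hx hxS
    refine ⟨?_, hxS.2.mono Finset.inter_subset_right⟩
    have := hxS.2 _ hvS
    obtain ⟨L, hL, hxL⟩ := mem_vertices.1 hxS.1
    rw [eS] at hL
    clear ih e eS eX he hX
    grind
  obtain ⟨h1, h2, h3⟩ := ih _ _ _ _ _ eS (hd.mono_left hsubX)
    (by
      rcases hj with ⟨h, h'⟩ | ⟨h, h'⟩
      · exact .inl ⟨hX _ h haS, h'⟩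
      · exact .inr ⟨h, hX _ h' hbS⟩) (fun h => hcX (hsubX h)) hcY
  refine ⟨?_, h2, h3⟩
  rw [eX]
  refine .tensor _ _ a' b' c' h1 hT (hdST.mono_left hsubS) ?_ (fun h => hcS (hsubS h)) hcT hσ
  rcases hjST with ⟨h, h'⟩ | ⟨h, h'⟩
  · exact .inl ⟨hin _ hwa h, h'⟩
  · exact .inr ⟨h, hin _ hwb h'⟩

/-- Both parts `S` and `T` are connected, so each is contained in the side of the separation that it
meets, and the two decompositions coincide. -/
theorem Seq.of_union_eq {σ : α → Conn} {S T X Y : Finset (Cell α)} (hS : Seq σ S) (hT : Seq σ T)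
    (e : S ∪ T = X ∪ Y) (hd : Disjoint (vertices X) (vertices Y)) {x y : α}
    (hxS : x ∈ vertices S) (hxX : x ∈ vertices X) (hyT : y ∈ vertices T) (hyY : y ∈ vertices Y) :
    Seq σ X ∧ Seq σ Y := by
  have h1 := hS.connected.subset (e ▸ Finset.subset_union_left) hd hxS hxX
  have h2 := hT.connected.subset
    (Finset.union_comm X Y ▸ e ▸ Finset.subset_union_right) hd.symm hyT hyY
  have hXY : ∀ L ∈ X, L ∉ Y := fun L => cell_notMem_of_disjoint hd
  have e1 : X = S := by ext L; have := Finset.ext_iff.1 e L; grind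
  have e2 : Y = T := by ext L; have := Finset.ext_iff.1 e L; grind
  exact ⟨e1 ▸ hS, e2 ▸ hT⟩

theorem Seq.splitsWell {σ : α → Conn} {S : Finset (Cell α)} (h : Seq σ S) : SplitsWell σ S := by
  induction h with
  | ident a b hab =>
    intro X Y a b c h
    have : Cell.mult a b c ∈ insert (Cell.mult a b c) (X ∪ Y) := by simp
    rw [← h] at this
    simp at this
  | par S a' b' c' hS ha hb hab hc' hσ ih =>
    intro X Y a b c e hd hj hcX hcY
    by_cases hw : Cell.mult a' b' c' = Cell.mult a b c
    -- A ⅋ that comes last cannot split: what it is put on is connected.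
    · exfalso
      have e' : S = X ∪ Y := by
        have h1 : Cell.mult a' b' c' ∉ S := fun h => hc' (mem_vertices.2 ⟨_, h, by simp⟩)
        have h2 : Cell.mult a b c ∉ X ∪ Y := fun h => by
          have : c ∈ vertices (X ∪ Y) := mem_vertices.2 ⟨_, h, by simp⟩
          rw [vertices_union, Finset.mem_union] at this
          tauto
        rw [← Finset.erase_insert h1, ← Finset.erase_insert h2, e, hw]
      exact not_connected_of_joins hd hj (e' ▸ hS.connected)
    · have : Cell.mult a' b' c' ∈ X ∪ Y := by
        have := Finset.ext_iff.1 e (Cell.mult a' b' c')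
        simpa [hw] using this
      rcases Finset.mem_union.1 this with h | h
      · exact ih.par_aux ha hb hab hc' hσ e hd hj hcX hcY hw h
      · have := ih.par_aux ha hb hab hc' hσ (by rwa [Finset.union_comm]) hd.symm hj.swap
          hcY hcX hw h
        tauto
  | tensor S T a' b' c' hS hT hd₀ hj₀ hcS hcT hσ ihS ihT =>
    intro X Y a b c e hd hj hcX hcY
    by_cases hw : Cell.mult a' b' c' = Cell.mult a b c
    · have e' : S ∪ T = X ∪ Y := by
        have h1 : Cell.mult a' b' c' ∉ S ∪ T := fun h => by
          have : c' ∈ vertices (S ∪ T) := mem_vertices.2 ⟨_, h, by simp⟩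
          rw [vertices_union, Finset.mem_union] at this
          tauto
        have h2 : Cell.mult a b c ∉ X ∪ Y := fun h => by
          have : c ∈ vertices (X ∪ Y) := mem_vertices.2 ⟨_, h, by simp⟩
          rw [vertices_union, Finset.mem_union] at this
          tauto
        rw [← Finset.erase_insert h1, ← Finset.erase_insert h2, e, hw]
      injection hw with h1 h2 h3
      subst h1 h2 h3
      rw [← and_assoc]
      refine ⟨?_, hσ⟩
      have e'' : S ∪ T = Y ∪ X := by rw [e', Finset.union_comm]
      rcases hj with ⟨ha, hb⟩ | ⟨ha, hb⟩ <;> rcases hj₀ with ⟨ha₀, hb₀⟩ | ⟨ha₀, hb₀⟩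
      · exact hS.of_union_eq hT e' hd ha₀.1 ha.1 hb₀.1 hb.1
      · exact (hS.of_union_eq hT e'' hd.symm hb₀.1 hb.1 ha₀.1 ha.1).symm
      · exact (hS.of_union_eq hT e'' hd.symm ha₀.1 ha.1 hb₀.1 hb.1).symm
      · exact hS.of_union_eq hT e' hd hb₀.1 hb.1 ha₀.1 ha.1
    · have h1 : Cell.mult a' b' c' ∈ X ∪ Y := by
        have := Finset.ext_iff.1 e (Cell.mult a' b' c')
        simpa [hw] using this
      have h2 : Cell.mult a b c ∈ S ∪ T := by
        have := Finset.ext_iff.1 e (Cell.mult a b c)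
        simpa [Ne.symm hw] using this
      rcases Finset.mem_union.1 h2 with h2 | h2 <;> rcases Finset.mem_union.1 h1 with h1 | h1
      · exact ihS.tensor_aux hd₀ hj₀ hcS hcT hT hσ e hd hj hcX hcY h2 h1
      · have := ihS.tensor_aux hd₀ hj₀ hcS hcT hT hσ (by rw [e, Finset.union_comm]) hd.symm hj.swap
          hcY hcX h2 h1
        tauto
      · exact ihT.tensor_aux hd₀.symm hj₀.swap hcT hcS hS hσ (by rw [← e, Finset.union_comm]) hd hj
          hcX hcY h2 h1
      · have := ihT.tensor_aux hd₀.symm hj₀.swap hcT hcS hS hσ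
          (by rw [Finset.union_comm, e, Finset.union_comm]) hd.symm hj.swap hcY hcX h2 h1
        tauto

/-- A splitting vertex is a `⊗`, and both parts are sequentializable. -/
theorem Seq.split {σ : α → Conn} {X Y : Finset (Cell α)} {a b c : α}
    (h : Seq σ (insert (Cell.mult a b c) (X ∪ Y))) (hd : Disjoint (vertices X) (vertices Y))
    (hj : Joins X Y a b) (hcX : c ∉ vertices X) (hcY : c ∉ vertices Y) :
    Seq σ X ∧ Seq σ Y ∧ σ c = Conn.tensor :=
  h.splitsWell X Y a b c rfl hd hj hcX hcY

/-- Everything outside what remains of `S` hangs on it at most at the premise `s` of the ⊗ in `S`. A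
colouring of the remaining cells of `S` therefore extends by the constant colour of `s`. -/
theorem Connected.erase_of_tensor {S T : Finset (Cell α)} {a b c a' b' c' : α}
    (hd : Disjoint (vertices S) (vertices T)) (hj : Joins S T a' b') (hcS : c' ∉ vertices S)
    (hv : Cell.mult a b c ∈ S)
    (hconn : Connected ((insert (Cell.mult a' b' c') (S ∪ T)).erase (Cell.mult a b c))) :
    Connected (S.erase (Cell.mult a b c)) := by
  have hd' := Finset.disjoint_left.1 hd
  have hvT := cell_notMem_of_disjoint hd hv
  have hwS : Cell.mult a' b' c' ∉ S := fun h => hcS (mem_vertices.2 ⟨_, h, by simp⟩)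
  have hwv : Cell.mult a' b' c' ≠ Cell.mult a b c := fun h => hwS (h ▸ hv)
  have hsub := vertices_mono (Finset.erase_subset (Cell.mult a b c) S)
  have key : ∀ s t : α, s ∈ vertices S → t ∈ vertices T →
      (∀ x ∈ (Cell.mult a' b' c').verts, x = s ∨ x = t ∨ x = c') →
      Connected (S.erase (Cell.mult a b c)) := by
    intro s t hs ht hst f hf x hx y hy hfx
    have := hconn (fun z => z ∈ vertices (S.erase (Cell.mult a b c)) ∧ f z ∨
      z ∉ vertices (S.erase (Cell.mult a b c)) ∧ f s) ?_ x ?_ y ?_ (.inl ⟨hx, hfx⟩)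
    · rcases this with h | h
      · exact h.2
      · exact absurd hy h.1
    · intro L hL z hz w hw
      rw [Finset.mem_erase, Finset.mem_insert, Finset.mem_union] at hL
      rcases hL with ⟨hne, rfl | hL | hL⟩
      · have hout : ∀ u, u = t ∨ u = c' → u ∉ vertices (S.erase (Cell.mult a b c)) := by
          rintro u (rfl | rfl) hu
          · exact hd' (hsub hu) ht
          · exact hcS (hsub hu)
        have hcol : ∀ u ∈ (Cell.mult a' b' c').verts,
            (u ∈ vertices (S.erase (Cell.mult a b c)) ∧ f u ∨
              u ∉ vertices (S.erase (Cell.mult a b c)) ∧ f s ↔ f s) := by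
          intro u hu
          rcases hst u hu with rfl | h
          · tauto
          · have := hout u h
            tauto
        rw [hcol z hz, hcol w hw]
        exact id
      · have hL' : L ∈ S.erase (Cell.mult a b c) := Finset.mem_erase.2 ⟨hne, hL⟩
        have h1 : z ∈ vertices (S.erase (Cell.mult a b c)) := mem_vertices.2 ⟨L, hL', hz⟩
        have h2 : w ∈ vertices (S.erase (Cell.mult a b c)) := mem_vertices.2 ⟨L, hL', hw⟩
        have := hf L hL' z hz w hw
        tauto
      · have h1 : z ∉ vertices (S.erase (Cell.mult a b c)) := fun h =>
          hd' (hsub h) (mem_vertices.2 ⟨L, hL, hz⟩)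
        have h2 : w ∉ vertices (S.erase (Cell.mult a b c)) := fun h =>
          hd' (hsub h) (mem_vertices.2 ⟨L, hL, hw⟩)
        tauto
    · exact vertices_mono (Finset.erase_subset_erase _ fun L hL => by simp [hL]) hx
    · exact vertices_mono (Finset.erase_subset_erase _ fun L hL => by simp [hL]) hy
  rcases hj with ⟨ha, hb⟩ | ⟨ha, hb⟩
  · exact key a' b' ha.1 hb.1 (by simp)
  · exact key b' a' hb.1 ha.1 (by simp)

/-! ### The exchange of two connectives -/

/-- Two labellings of the vertices that differ at two nodes of `S` at most. -/
def Close (S : Finset (Cell α)) (σ τ : α → Conn) : Prop :=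
  ∃ p q, ∀ x, IsNode S x → x ≠ p → x ≠ q → σ x = τ x

theorem isNode_insert {S : Finset (Cell α)} {a b c x : α} :
    IsNode (insert (Cell.mult a b c) S) x ↔ x = c ∨ IsNode S x := by
  unfold IsNode
  simp only [Finset.mem_insert, Cell.mult.injEq]
  grind

theorem isNode_union {S T : Finset (Cell α)} {x : α} :
    IsNode (S ∪ T) x ↔ IsNode S x ∨ IsNode T x := by
  unfold IsNode
  simp only [Finset.mem_union]
  grind

theorem Seq.par_update {τ : α → Conn} {S : Finset (Cell α)} {a b c : α} (hS : Seq τ S)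
    (ha : IsExit S a) (hb : IsExit S b) (hab : a ≠ b) (hc : c ∉ vertices S) :
    Seq (Function.update τ c Conn.par) (insert (Cell.mult a b c) S) := by
  refine .par _ _ _ _ (hS.congr fun x hx => ?_) ha hb hab hc (by simp)
  rw [Function.update_of_ne]
  rintro rfl
  exact hc hx.mem_vertices

/-- `τ` is a sequentializable labelling close to `σ` in which the vertex `c` is a `⅋`. -/
def CloseParAt (S : Finset (Cell α)) (σ : α → Conn) (c : α) : Prop :=
  ∃ τ, Seq τ S ∧ τ c = Conn.par ∧ Close S σ τ

/-- The new labelling of `S` is glued to `σ`, which stays in force on `T` and at the ⊗ itself. -/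
theorem CloseParAt.tensor {σ : α → Conn} {S T : Finset (Cell α)} {a' b' c' c : α}
    (h : CloseParAt S σ c) (hc : c ∈ vertices S) (hT : Seq σ T)
    (hd : Disjoint (vertices S) (vertices T)) (hj : Joins S T a' b') (hcS : c' ∉ vertices S)
    (hcT : c' ∉ vertices T) (hσ : σ c' = Conn.tensor) :
    CloseParAt (insert (Cell.mult a' b' c') (S ∪ T)) σ c := by
  obtain ⟨τ, hτ, hτc, p, q, hpq⟩ := h
  have hd' := Finset.disjoint_left.1 hd
  refine ⟨fun x => if x ∈ vertices S then τ x else σ x, ?_, by simp [hc, hτc], p, q, ?_⟩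
  · refine .tensor _ _ _ _ _ (hτ.congr fun x hx => ?_) (hT.congr fun x hx => ?_) hd hj hcS hcT ?_
    · simp [hx.mem_vertices]
    · rw [if_neg fun h => hd' h hx.mem_vertices]
    · simp [hcS, hσ]
  · intro x hx hxp hxq
    simp only
    split_ifs with h
    · rw [isNode_insert, isNode_union] at hx
      rcases hx with rfl | hx | hx
      · exact absurd h hcS
      · exact hpq x hx hxp hxq
      · exact absurd hx.mem_vertices (hd' h)
    · rfl

/-- Without the cell of `c`, the rest `R` falls into two pieces, which are sequentializable by
`Seq.split`. The cell of `c'` joins the same two pieces, because it also makes `R` connected. So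
`c'` may serve as the ⊗ between them, and `c` may follow as a ⅋; no other label moves. -/
theorem closeParAt_of_separation {σ : α → Conn} {R : Finset (Cell α)} {a b c a' b' c' : α}
    (hS : Seq σ (insert (Cell.mult a b c) R)) (hcE : c ∉ vertices R) (haE : IsExit R a)
    (hbE : IsExit R b) (hab' : a ≠ b) (haE' : IsExit R a') (hbE' : IsExit R b')
    (hc'E : c' ∉ vertices R) (hcw : c ∉ (Cell.mult a' b' c').prems) (hcc' : c ≠ c')
    (hva : a ∉ (Cell.mult a' b' c').prems) (hvb : b ∉ (Cell.mult a' b' c').prems)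
    (hconn : Connected (insert (Cell.mult a' b' c') R)) (hE : ¬ Connected R) :
    CloseParAt (insert (Cell.mult a b c) (insert (Cell.mult a' b' c') R)) σ c := by
  have hcon := hS.connected
  obtain ⟨X, Y, rfl, hd, hX, hY⟩ := exists_separation hE
  have hcX : c ∉ vertices X := fun h => hcE (by simp [vertices_union, h])
  have hcY : c ∉ vertices Y := fun h => hcE (by simp [vertices_union, h])
  have hcX' : c' ∉ vertices X := fun h => hc'E (by simp [vertices_union, h])
  have hcY' : c' ∉ vertices Y := fun h => hc'E (by simp [vertices_union, h])
  obtain ⟨h1, h2, -⟩ := hS.split hd (hcon.joins hd hX hY haE hbE hcE) hcX hcY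
  have hj := hconn.joins hd hX hY haE' hbE' hc'E
  have upd : ∀ Z : Finset (Cell α), c' ∉ vertices Z → Seq σ Z →
      Seq (Function.update σ c' Conn.tensor) Z := by
    intro Z hZ h
    refine h.congr fun x hx => ?_
    rw [Function.update_of_ne]
    rintro rfl
    exact hZ hx.mem_vertices
  have h3 : Seq (Function.update σ c' Conn.tensor) (insert (Cell.mult a' b' c') (X ∪ Y)) :=
    .tensor X Y a' b' c' (upd X hcX' h1) (upd Y hcY' h2) hd hj hcX' hcY' (by simp)
  refine ⟨_, h3.par_update (haE.insert hva) (hbE.insert hvb) hab' ?_, by simp, c, c', ?_⟩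
  · intro h
    obtain ⟨L, hL, hcL⟩ := mem_vertices.1 h
    rcases Finset.mem_insert.1 hL with rfl | hL
    · simp at hcw hcL
      tauto
    · exact hcE (mem_vertices.2 ⟨L, hL, hcL⟩)
  · intro x _ hxc hxc'
    simp [hxc, hxc']

/-- A terminal vertex of a sequentializable skeleton that is not splitting can be turned into a `⅋`
by changing the labels of two nodes at most. -/
theorem Seq.closeParAt {σ : α → Conn} {S : Finset (Cell α)} (h : Seq σ S) :
    ∀ a b c, Cell.mult a b c ∈ S → IsTerminal S c → Connected (S.erase (Cell.mult a b c)) →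
      CloseParAt S σ c := by
  induction h with
  | ident a b hab => intro a b c hv; simp at hv
  | par S a' b' c' hS ha hb hab hc' hσ ih =>
    intro a b c hv hc hconn
    by_cases hw : Cell.mult a b c = Cell.mult a' b' c'
    · injection hw with _ _ h
      subst h
      -- No label changes here; `c` fills both places of exceptional nodes.
      exact ⟨σ, .par S a' b' c hS ha hb hab hc' hσ, hσ, c, c, fun _ _ _ _ => rfl⟩
    have hvS : Cell.mult a b c ∈ S := by
      simpa [Finset.mem_insert, hw] using hv
    have hcV : c ∈ vertices S := mem_vertices.2 ⟨_, hvS, by simp⟩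
    have hcc' : c ≠ c' := fun h => hc' (h ▸ hcV)
    have hcS : IsTerminal S c := hc.mono (Finset.subset_insert _ _)
    -- If `S` stays connected without the cell of `c`, the induction hypothesis applies above the
    -- last ⅋; otherwise the last ⅋ alone reconnects the pieces, and the exchange applies.
    by_cases hE : Connected (S.erase (Cell.mult a b c))
    · obtain ⟨τ, hτ, hτc, p, q, hpq⟩ := ih a b c hvS hcS hE
      refine ⟨_, hτ.par_update ha hb hab hc', by simp [hcc', hτc], p, q, ?_⟩
      intro x hx hxp hxq
      rw [isNode_insert] at hx
      by_cases hxc : x = c'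
      · simp [hxc, hσ]
      · simp only [hxc, false_or] at hx
        simp [hxc, hpq x hx hxp hxq]
    · obtain ⟨hcE, haE, hbE, hab'⟩ := hS.erase_terminal hvS hcS
      rw [Finset.erase_insert_of_ne (Ne.symm hw)] at hconn
      have hsub := vertices_mono (Finset.erase_subset (Cell.mult a b c) S)
      have hcw := hc (Cell.mult a' b' c') (by simp)
      have hin : ∀ x, IsExit S x → x ≠ c → IsExit (S.erase (Cell.mult a b c)) x := by
        intro x hx hxc
        refine ⟨?_, hx.2.mono (Finset.erase_subset _ _)⟩
        obtain ⟨L, hL, hxL⟩ := mem_vertices.1 hx.1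
        refine mem_vertices.2 ⟨L, Finset.mem_erase.2 ⟨?_, hL⟩, hxL⟩
        rintro rfl
        have h := hx.2 _ hvS
        rw [Cell.mem_prems_mult] at h
        rcases (Cell.mem_verts_mult _ _ _ _).1 hxL with h' | h' | h'
        · exact h (.inl h')
        · exact h (.inr h')
        · exact hxc h'
      have haE' := hin a' ha (by rintro rfl; simp at hcw)
      have hbE' := hin b' hb (by rintro rfl; simp at hcw)
      have hprem : ∀ x, x = a ∨ x = b → x ∉ (Cell.mult a' b' c').prems := by
        intro x hx h
        rcases (Cell.mem_prems_mult _ _ _ _).1 h with rfl | rfl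
        · exact ha.2 _ hvS ((Cell.mem_prems_mult _ _ _ _).2 hx)
        · exact hb.2 _ hvS ((Cell.mem_prems_mult _ _ _ _).2 hx)
      have eS : S = insert (Cell.mult a b c) (S.erase (Cell.mult a b c)) :=
        (Finset.insert_erase hvS).symm
      have hc'E : c' ∉ vertices (S.erase (Cell.mult a b c)) := fun h => hc' (hsub h)
      have := closeParAt_of_separation (eS ▸ hS) hcE haE hbE hab' haE' hbE' hc'E hcw hcc'
        (hprem a (.inl rfl)) (hprem b (.inr rfl)) hconn hE
      rwa [Finset.insert_comm, ← eS] at this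
  | tensor S T a' b' c' hS hT hd hj hcS hcT hσ ihS ihT =>
    intro a b c hv hc hconn
    by_cases hw : Cell.mult a b c = Cell.mult a' b' c'
    · exfalso
      -- The final ⊗ is itself splitting, which the connectedness hypothesis excludes.
      rw [hw, Finset.erase_insert] at hconn
      · exact not_connected_of_joins hd hj hconn
      · intro h
        have : c' ∈ vertices (S ∪ T) := mem_vertices.2 ⟨_, h, by simp⟩
        rw [vertices_union, Finset.mem_union] at this
        tauto
    have hvS : Cell.mult a b c ∈ S ∪ T := by
      simpa [Finset.mem_insert, hw] using hv
    rcases Finset.mem_union.1 hvS with hvS | hvS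
    · exact (ihS a b c hvS (hc.mono fun L hL => by simp [hL])
        (hconn.erase_of_tensor hd hj hcS hvS)).tensor (mem_vertices.2 ⟨_, hvS, by simp⟩)
        hT hd hj hcS hcT hσ
    · rw [Finset.union_comm] at hconn hc ⊢
      exact (ihT a b c hvS (hc.mono fun L hL => by simp [hL])
        (hconn.erase_of_tensor hd.symm hj.swap hcT hvS)).tensor (mem_vertices.2 ⟨_, hvS, by simp⟩)
        hS hd.symm hj.swap hcT hcS hσ

/-! ### Chains of sequentializable labellings -/

/-- Two close sequentializable labellings of `S`. -/
def Step (S : Finset (Cell α)) (σ τ : α → Conn) : Prop := Seq σ S ∧ Seq τ S ∧ Close S σ τ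

theorem Step.tensor {S T : Finset (Cell α)} {a b c : α} {ρ : α → Conn} (hT : Seq ρ T)
    (hd : Disjoint (vertices S) (vertices T)) (hj : Joins S T a b) (hcS : c ∉ vertices S)
    (hcT : c ∉ vertices T) (hρ : ρ c = Conn.tensor) {υ υ' : α → Conn} (h : Step S υ υ') :
    Step (insert (Cell.mult a b c) (S ∪ T)) (fun x => if x ∈ vertices S then υ x else ρ x)
      (fun x => if x ∈ vertices S then υ' x else ρ x) := by
  have hd' := Finset.disjoint_left.1 hd
  have key : ∀ υ : α → Conn, Seq υ S → Seq (fun x => if x ∈ vertices S then υ x else ρ x)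
      (insert (Cell.mult a b c) (S ∪ T)) := by
    intro υ hυ
    refine .tensor _ _ _ _ _ (hυ.congr fun x hx => ?_) (hT.congr fun x hx => ?_) hd hj hcS hcT ?_
    · simp [hx.mem_vertices]
    · rw [if_neg fun h => hd' h hx.mem_vertices]
    · simp [hcS, hρ]
  obtain ⟨h1, h2, p, q, hpq⟩ := h
  refine ⟨key υ h1, key υ' h2, p, q, fun x hx hxp hxq => ?_⟩
  simp only
  split_ifs with h
  · rw [isNode_insert, isNode_union] at hx
    rcases hx with rfl | hx | hx
    · exact absurd h hcS
    · exact hpq x hx hxp hxq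
    · exact absurd hx.mem_vertices (hd' h)
  · rfl

/-- Any two sequentializable labellings of the same skeleton are joined by a chain of
sequentializable labellings in which neighbours differ at two nodes at most. -/
theorem Seq.chain {τ : α → Conn} {S : Finset (Cell α)} (h : Seq τ S) :
    ∀ {σ : α → Conn}, Seq σ S → Relation.ReflTransGen (Step S) σ τ := by
  induction h with
  | ident a b hab =>
    intro σ hσ
    refine .single ⟨hσ, .ident a b hab, a, a, ?_⟩
    rintro x ⟨y, z, h⟩
    simp at h
  | par S a b c hS ha hb hab hc hτ ih =>
    intro σ hσ
    have hcS : Cell.mult a b c ∉ S := fun h => hc (mem_vertices.2 ⟨_, h, by simp⟩)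
    have hterm : IsTerminal (insert (Cell.mult a b c) S) c := by
      intro L hL h
      rcases Finset.mem_insert.1 hL with rfl | hL
      · have ha := ha.1
        have hb := hb.1
        simp at h
        rcases h with rfl | rfl <;> contradiction
      · exact hc (mem_vertices.2 ⟨L, hL, L.prems_subset_verts h⟩)
    -- The skeleton above the final ⅋ of `τ` is connected, so `c` is not splitting and one step from
    -- `σ` makes it a ⅋.
    obtain ⟨ρ, hρ, hρc, hclose⟩ := hσ.closeParAt a b c (by simp) hterm
      (by rw [Finset.erase_insert hcS]; exact hS.connected)
    have hρS := hρ.erase_par (Finset.mem_insert_self _ _) hterm hρc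
    rw [Finset.erase_insert hcS] at hρS
    refine .head ⟨hσ, hρ, hclose⟩ ?_
    have eρ : Function.update ρ c Conn.par = ρ := by rw [← hρc, Function.update_eq_self]
    have eτ : Function.update τ c Conn.par = τ := by rw [← hτ, Function.update_eq_self]
    -- The chain on `S` is carried below `c` by forcing the label ⅋ at `c` throughout; this leaves
    -- both endpoints as they are.
    have : Relation.ReflTransGen (Step (insert (Cell.mult a b c) S))
        (Function.update ρ c Conn.par) (Function.update τ c Conn.par) :=
      (ih hρS).lift (fun υ => Function.update υ c Conn.par) ?_
    · rwa [eρ, eτ] at this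
    · rintro υ υ' ⟨h1, h2, p, q, hpq⟩
      refine ⟨h1.par_update ha hb hab hc, h2.par_update ha hb hab hc, p, q, ?_⟩
      intro x hx hxp hxq
      by_cases hxc : x = c
      · simp [hxc]
      · simp only [isNode_insert, hxc, false_or] at hx
        simp [hxc, hpq x hx hxp hxq]
  | tensor S T a b c hS hT hd hj hcS hcT hτ ihS ihT =>
    intro σ hσ
    obtain ⟨h1, h2, h3⟩ := hσ.split hd hj hcS hcT
    have hd' := Finset.disjoint_left.1 hd
    -- Labels on `S` move from `σ` to `τ` while `T` keeps `σ`; then `c2` moves those on `T`. The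
    -- label at `c` is ⊗ all along.
    have c1 : Relation.ReflTransGen (Step (insert (Cell.mult a b c) (S ∪ T)))
        (fun x => if x ∈ vertices S then σ x else σ x)
        (fun x => if x ∈ vertices S then τ x else σ x) :=
      (ihS h1).lift _ fun _ _ h => h.tensor h2 hd hj hcS hcT h3
    have hρS : Seq (fun x => if x ∈ vertices S then τ x else σ x) S :=
      hS.congr fun x hx => by simp [hx.mem_vertices]
    have c2 : Relation.ReflTransGen (Step (insert (Cell.mult a b c) (T ∪ S)))
        (fun x => if x ∈ vertices T then σ x else if x ∈ vertices S then τ x else σ x)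
        (fun x => if x ∈ vertices T then τ x else if x ∈ vertices S then τ x else σ x) :=
      (ihT h2).lift _ fun _ _ h => h.tensor hρS hd.symm hj.swap hcT hcS (by simp [hcS, h3])
    rw [Finset.union_comm T S] at c2
    have e1 : (fun x => if x ∈ vertices S then σ x else σ x) = σ := by simp
    have e2 : (fun x => if x ∈ vertices T then σ x else
        if x ∈ vertices S then τ x else σ x) = fun x => if x ∈ vertices S then τ x else σ x := by
      ext x
      split_ifs with h h'
      · exact absurd h (hd' h')
      all_goals rfl
    rw [e1] at c1
    rw [e2] at c2
    have hτS := Seq.tensor S T a b c hS hT hd hj hcS hcT hτ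
    have agree : ∀ x, IsNode (insert (Cell.mult a b c) (S ∪ T)) x →
        τ x = if x ∈ vertices T then τ x else if x ∈ vertices S then τ x else σ x := by
      intro x hx
      rw [isNode_insert, isNode_union] at hx
      rcases hx with rfl | hx | hx
      · simp [hcS, hcT, h3, hτ]
      · simp [hx.mem_vertices]
      · simp [hx.mem_vertices]
    -- The glued labelling equals `τ` at nodes only, so one more step that changes no node is needed
    -- to reach `τ` as a function.
    exact (c1.trans c2).tail ⟨hτS.congr agree, hτS, c, c, fun x hx _ _ => (agree x hx).symm⟩

/-! ### Counting the tensors -/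

open Classical in
/-- The nodes of `S` labelled by `⊗`. -/
noncomputable def tensorNodes (σ : α → Conn) (S : Finset (Cell α)) : Finset α :=
  (vertices S).filter fun c => IsNode S c ∧ σ c = Conn.tensor

theorem mem_tensorNodes {σ : α → Conn} {S : Finset (Cell α)} {c : α} :
    c ∈ tensorNodes σ S ↔ IsNode S c ∧ σ c = Conn.tensor := by
  simp only [tensorNodes, Finset.mem_filter, and_iff_right_iff_imp]
  exact fun h => h.1.mem_vertices

/-- The identity cells of `S`. -/
def identCells (S : Finset (Cell α)) : Finset (Cell α) :=
  S.filter fun L => L.prems = ∅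

/-- The right-hand side ignores the labels. A ⅋ adds to neither side, and a ⊗ adds one tensor while
the two `+ 1` of its parts merge into one. -/
theorem Seq.card_tensorNodes {σ : α → Conn} {S : Finset (Cell α)} (h : Seq σ S) :
    (tensorNodes σ S).card + 1 = (identCells S).card := by
  induction h with
  | ident a b hab =>
    have h1 : tensorNodes σ {Cell.ident a b} = ∅ := by
      ext x
      simp [mem_tensorNodes, IsNode]
    have h2 : identCells {Cell.ident a b} = {Cell.ident a b} := by
      ext x
      simp only [identCells, Finset.mem_filter, Finset.mem_singleton]
      constructor
      · exact fun h => h.1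
      · rintro rfl; exact ⟨rfl, rfl⟩
    simp [h1, h2]
  | par S a b c hS ha hb hab hc hσ ih =>
    have h1 : tensorNodes σ (insert (Cell.mult a b c) S) = tensorNodes σ S := by
      ext x
      simp only [mem_tensorNodes, isNode_insert]
      constructor
      · rintro ⟨rfl | h, h'⟩
        · simp [hσ] at h'
        · exact ⟨h, h'⟩
      · tauto
    have h2 : identCells (insert (Cell.mult a b c) S) = identCells S := by
      unfold identCells
      rw [Finset.filter_insert, if_neg (by simp [Cell.prems])]
    rw [h1, h2, ih]
  | tensor S T a b c hS hT hd hj hcS hcT hσ ihS ihT =>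
    have hd' := Finset.disjoint_left.1 hd
    have h1 : tensorNodes σ (insert (Cell.mult a b c) (S ∪ T)) =
        insert c (tensorNodes σ S ∪ tensorNodes σ T) := by
      ext x
      simp only [mem_tensorNodes, isNode_insert, isNode_union, Finset.mem_insert,
        Finset.mem_union]
      constructor
      · tauto
      · rintro (rfl | h | h) <;> tauto
    have h2 : identCells (insert (Cell.mult a b c) (S ∪ T)) = identCells S ∪ identCells T := by
      unfold identCells
      rw [Finset.filter_insert, if_neg (by simp [Cell.prems]), Finset.filter_union]
    rw [h1, h2, Finset.card_insert_of_notMem, Finset.card_union_of_disjoint,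
      Finset.card_union_of_disjoint, ← ihS, ← ihT]
    · omega
    · rw [Finset.disjoint_left]
      intro L hL hL'
      exact cell_notMem_of_disjoint hd (Finset.mem_filter.1 hL).1 (Finset.mem_filter.1 hL').1
    · rw [Finset.disjoint_left]
      intro x hx hx'
      exact hd' (mem_tensorNodes.1 hx).1.mem_vertices (mem_tensorNodes.1 hx').1.mem_vertices
    · rw [Finset.mem_union, mem_tensorNodes, mem_tensorNodes]
      rintro (h | h)
      · exact hcS h.1.mem_vertices
      · exact hcT h.1.mem_vertices

/-- Two sequentializable labellings cannot differ at exactly one node. -/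
theorem Seq.not_differ_once {σ τ : α → Conn} {S : Finset (Cell α)} (hσ : Seq σ S) (hτ : Seq τ S)
    {p : α} (hp : IsNode S p) (hne : σ p ≠ τ p) (h : ∀ x, IsNode S x → x ≠ p → σ x = τ x) :
    False := by
  have key : ∀ {σ τ : α → Conn}, σ p = Conn.tensor → τ p = Conn.par →
      (∀ x, IsNode S x → x ≠ p → σ x = τ x) →
      (tensorNodes σ S).card = (tensorNodes τ S).card + 1 := by
    intro σ τ h1 h2 h
    have : tensorNodes σ S = insert p (tensorNodes τ S) := by
      ext x
      rw [Finset.mem_insert, mem_tensorNodes, mem_tensorNodes]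
      by_cases hx : x = p
      · simp [hx, hp, h1]
      · simp only [hx, false_or]
        exact and_congr_right fun hx' => by rw [h x hx' hx]
    rw [this, Finset.card_insert_of_notMem]
    simp [mem_tensorNodes, h2]
  have h1 := hσ.card_tensorNodes
  have h2 := hτ.card_tensorNodes
  cases hs : σ p <;> cases ht : τ p
  · exact hne (hs.trans ht.symm)
  · have := key hs ht h
    omega
  · have := key ht hs fun x hx hxp => (h x hx hxp).symm
    omega
  · exact hne (hs.trans ht.symm)

end Skeleton
-- Transport along injective maps of vertices
/-- The image of a cell under a map of vertices. -/
def Cell.map {α β : Type} (f : α → β) : Cell α → Cell β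
  | .ident a b => .ident (f a) (f b)
  | .mult a b c => .mult (f a) (f b) (f c)

theorem Cell.map_map {α β γ : Type} (f : α → β) (g : β → γ) (L : Cell α) :
    (L.map f).map g = L.map (g ∘ f) := by
  cases L <;> rfl

theorem Cell.map_id {α : Type} (L : Cell α) : L.map id = L := by
  cases L <;> rfl

section Map

variable {α β : Type} [DecidableEq α]

theorem Cell.map_congr {f g : α → β} {L : Cell α} (h : ∀ x ∈ L.verts, f x = g x) :
    L.map f = L.map g := by
  cases L <;> simp_all [Cell.map]

variable [DecidableEq β]

theorem Cell.prems_map (f : α → β) (L : Cell α) : (L.map f).prems = L.prems.image f := by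
  cases L <;> simp [Cell.map, Cell.prems, Finset.image_insert]

theorem Cell.verts_map (f : α → β) (L : Cell α) : (L.map f).verts = L.verts.image f := by
  cases L <;> simp [Cell.map, Cell.verts, Finset.image_insert]

theorem vertices_image (f : α → β) (S : Finset (Cell α)) :
    vertices (S.image (Cell.map f)) = (vertices S).image f := by
  ext y
  simp only [mem_vertices, Finset.mem_image, exists_exists_and_eq_and, Cell.verts_map]
  grind

theorem IsExit.image {S : Finset (Cell α)} {x : α} (h : IsExit S x) {f : α → β}
    (hf : Set.InjOn f (vertices S)) : IsExit (S.image (Cell.map f)) (f x) := by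
  refine ⟨by rw [vertices_image]; exact Finset.mem_image_of_mem f h.1, ?_⟩
  intro L hL hx
  obtain ⟨L, hLS, rfl⟩ := Finset.mem_image.1 hL
  rw [Cell.prems_map] at hx
  obtain ⟨y, hy, e⟩ := Finset.mem_image.1 hx
  have hyS : y ∈ vertices S := mem_vertices.2 ⟨L, hLS, L.prems_subset_verts hy⟩
  rw [hf hyS h.1 e] at hy
  exact h.2 L hLS hy

theorem Seq.image {σ : α → Conn} {τ : β → Conn} {S : Finset (Cell α)} {f : α → β} (h : Seq σ S)
    (hf : Set.InjOn f (vertices S)) (hτ : ∀ x, IsNode S x → τ (f x) = σ x) :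
    Seq τ (S.image (Cell.map f)) := by
  induction h with
  | ident a b hab =>
    rw [Finset.image_singleton]
    refine .ident _ _ fun e => hab (hf ?_ ?_ e) <;> simp [mem_vertices]
  | par S a b c hS ha hb hab hc hσ ih =>
    have hsub := vertices_mono (Finset.subset_insert (Cell.mult a b c) S)
    have hf' : Set.InjOn f (vertices S) := hf.mono (by exact_mod_cast hsub)
    have hcV : c ∈ vertices (insert (Cell.mult a b c) S) :=
      mem_vertices.2 ⟨_, Finset.mem_insert_self _ _, by simp⟩
    rw [Finset.image_insert]
    refine .par _ _ _ _ (ih hf' fun x hx => hτ x (isNode_insert.2 (.inr hx))) (ha.image hf')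
      (hb.image hf') (fun e => hab (hf' ha.1 hb.1 e)) ?_ ?_
    · rw [vertices_image, Finset.mem_image]
      rintro ⟨x, hx, e⟩
      rw [hf (hsub hx) hcV e] at hx
      exact hc hx
    · rw [hτ c (isNode_insert.2 (.inl rfl)), hσ]
  | tensor S T a b c hS hT hd hj hcS hcT hσ ihS ihT =>
    have hsubS : vertices S ⊆ vertices (insert (Cell.mult a b c) (S ∪ T)) :=
      vertices_mono fun L hL => by simp [hL]
    have hsubT : vertices T ⊆ vertices (insert (Cell.mult a b c) (S ∪ T)) :=
      vertices_mono fun L hL => by simp [hL]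
    have hfS : Set.InjOn f (vertices S) := hf.mono (by exact_mod_cast hsubS)
    have hfT : Set.InjOn f (vertices T) := hf.mono (by exact_mod_cast hsubT)
    have hcV : c ∈ vertices (insert (Cell.mult a b c) (S ∪ T)) :=
      mem_vertices.2 ⟨_, Finset.mem_insert_self _ _, by simp⟩
    rw [Finset.image_insert, Finset.image_union]
    refine .tensor _ _ _ _ _
      (ihS hfS fun x hx => hτ x (isNode_insert.2 (.inr (isNode_union.2 (.inl hx)))))
      (ihT hfT fun x hx => hτ x (isNode_insert.2 (.inr (isNode_union.2 (.inr hx))))) ?_ ?_ ?_ ?_ ?_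
    · rw [vertices_image, vertices_image, Finset.disjoint_left]
      intro y hy hy'
      obtain ⟨x, hx, rfl⟩ := Finset.mem_image.1 hy
      obtain ⟨x', hx', e⟩ := Finset.mem_image.1 hy'
      rw [hf (hsubT hx') (hsubS hx) e] at hx'
      exact Finset.disjoint_left.1 hd hx hx'
    · rcases hj with ⟨h, h'⟩ | ⟨h, h'⟩
      · exact .inl ⟨h.image hfS, h'.image hfT⟩
      · exact .inr ⟨h.image hfT, h'.image hfS⟩
    · rw [vertices_image, Finset.mem_image]
      rintro ⟨x, hx, e⟩
      rw [hf (hsubS hx) hcV e] at hx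
      exact hcS hx
    · rw [vertices_image, Finset.mem_image]
      rintro ⟨x, hx, e⟩
      rw [hf (hsubT hx) hcV e] at hx
      exact hcT hx
    · rw [hτ c (isNode_insert.2 (.inl rfl)), hσ]

/-- For the converse, the image is mapped back by a left inverse of `f` on the vertices; `Nonempty
α` provides its value elsewhere. -/
theorem seq_image_iff [Nonempty α] {τ : β → Conn} {S : Finset (Cell α)} {f : α → β}
    (hf : Set.InjOn f (vertices S)) :
    Seq τ (S.image (Cell.map f)) ↔ Seq (fun x => τ (f x)) S := by
  refine ⟨fun h => ?_, fun h => h.image hf fun _ _ => rfl⟩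
  have hg : ∀ x ∈ vertices S, Function.invFunOn f (vertices S) (f x) = x := fun x hx =>
    hf.leftInvOn_invFunOn hx
  have e : (S.image (Cell.map f)).image (Cell.map (Function.invFunOn f (vertices S))) = S := by
    rw [Finset.image_image]
    conv_rhs => rw [← Finset.image_id (s := S)]
    refine Finset.image_congr fun L hL => ?_
    rw [Function.comp_apply, Cell.map_map, id, ← Cell.map_id L, Cell.map_map]
    refine Cell.map_congr fun x hx => ?_
    exact hg x (mem_vertices.2 ⟨L, hL, by simpa [Cell.map_id] using hx⟩)
  rw [← e]
  refine h.image ?_ ?_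
  · rw [vertices_image]
    intro y hy z hz hyz
    rw [Finset.mem_coe, Finset.mem_image] at hy hz
    obtain ⟨y, hy, rfl⟩ := hy
    obtain ⟨z, hz, rfl⟩ := hz
    rw [hg y hy, hg z hz] at hyz
    rw [hyz]
  · rintro x ⟨a, b, hx⟩
    obtain ⟨L, hL, e⟩ := Finset.mem_image.1 hx
    cases L with
    | ident _ _ => simp [Cell.map] at e
    | mult a b c =>
      simp only [Cell.map, Cell.mult.injEq] at e
      obtain ⟨-, -, rfl⟩ := e
      rw [hg c (mem_vertices.2 ⟨_, hL, by simp⟩)]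

/-- A vertex is a conclusion of the cell that introduced it. Thus a sequentializable set of cells
contains the origins of all its premises, which is what `ProofStructure.restrict` asks for. -/
theorem Seq.exists_concl {σ : α → Conn} {S : Finset (Cell α)} (h : Seq σ S) :
    ∀ x ∈ vertices S, ∃ L ∈ S, x ∈ L.verts ∧ x ∉ L.prems := by
  have base : ∀ {S : Finset (Cell α)} {a b c : α}, a ∈ vertices S → b ∈ vertices S →
      c ∉ vertices S → (∀ x ∈ vertices S, ∃ L ∈ S, x ∈ L.verts ∧ x ∉ L.prems) →
      ∀ x ∈ vertices (insert (Cell.mult a b c) S),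
        ∃ L ∈ insert (Cell.mult a b c) S, x ∈ L.verts ∧ x ∉ L.prems := by
    intro S a b c ha hb hc ih x hx
    by_cases hxS : x ∈ vertices S
    · obtain ⟨L, hL, h⟩ := ih x hxS
      exact ⟨L, Finset.mem_insert_of_mem hL, h⟩
    · refine ⟨_, Finset.mem_insert_self _ _, ?_⟩
      grind
  induction h with
  | ident a b hab =>
    intro x hx
    obtain ⟨L, hL, h⟩ := mem_vertices.1 hx
    rw [Finset.mem_singleton] at hL
    subst hL
    exact ⟨_, Finset.mem_singleton_self _, h, by simp⟩
  | par S a b c hS ha hb hab hc hσ ih => exact base ha.1 hb.1 hc ih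
  | tensor S T a b c hS hT hd hj hcS hcT hσ ihS ihT =>
    have hab : a ∈ vertices (S ∪ T) ∧ b ∈ vertices (S ∪ T) := by
      simp only [vertices_union, Finset.mem_union]
      rcases hj with ⟨h, h'⟩ | ⟨h, h'⟩
      · exact ⟨.inl h.1, .inr h'.1⟩
      · exact ⟨.inr h.1, .inl h'.1⟩
    refine base hab.1 hab.2 (by simp [vertices_union, hcS, hcT]) ?_
    intro x hx
    rw [vertices_union, Finset.mem_union] at hx
    rcases hx with hx | hx
    · obtain ⟨L, hL, h⟩ := ihS x hx
      exact ⟨L, Finset.mem_union_left _ hL, h⟩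
    · obtain ⟨L, hL, h⟩ := ihT x hx
      exact ⟨L, Finset.mem_union_right _ hL, h⟩

end Map

/-! ### Proof nets as sequentializable labellings of skeletons -/

/-- A link as a cell on formula occurrences. -/
def Link.toCell : Link → Cell Occ
  | .ident i j => .ident (Formula.pos, i) (Formula.neg, j)
  | .mult c X Y k => .mult X Y (multConcl c X Y k)

/-- The main connective of the formula of an occurrence. -/
def mainConn : Occ → Conn
  | (.tensor _ _, _) => .tensor
  | _ => .par

theorem mainConn_multConcl (c : Conn) (X Y : Occ) (k : ℕ) : mainConn (multConcl c X Y k) = c := by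
  cases c <;> rfl

/-- The cell forgets the kind and the index of a link, but both can be read off the conclusion
occurrence. -/
theorem Link.toCell_injective : Function.Injective Link.toCell := by
  intro L M h
  cases L <;> cases M <;> simp only [Link.toCell, Cell.ident.injEq, Cell.mult.injEq, Prod.mk.injEq,
    true_and, reduceCtorEq] at h
  · rw [h.1, h.2]
  · obtain ⟨rfl, rfl, h⟩ := h
    have h1 := congrArg mainConn h
    rw [mainConn_multConcl, mainConn_multConcl] at h1
    have h2 := congrArg Prod.snd h
    simp only [multConcl] at h2
    rw [h1, h2]

theorem Link.prems_toCell (L : Link) : L.toCell.prems = L.premises := by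
  cases L <;> rfl

theorem Link.verts_toCell (L : Link) : L.toCell.verts = L.premises ∪ L.conclusions := by
  cases L
  · simp [Link.toCell, Cell.verts, Link.premises, Link.conclusions]
  · ext x
    simp [Link.toCell, Cell.verts, Link.premises, Link.conclusions]

namespace ProofStructure

/-- The skeleton of a proof structure. -/
def skel (Θ : ProofStructure) : Finset (Cell Occ) := Θ.links.image Link.toCell

theorem vertices_skel (Θ : ProofStructure) : vertices Θ.skel = Θ.forms := by
  ext X
  rw [mem_vertices]
  constructor
  · rintro ⟨L, hL, hX⟩
    obtain ⟨L, hL', rfl⟩ := Finset.mem_image.1 hL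
    rw [Link.verts_toCell] at hX
    exact Finset.union_subset (Θ.premises_subset L hL') (Θ.conclusions_subset L hL') hX
  · intro hX
    obtain ⟨L, ⟨hL, hXL⟩, -⟩ := Θ.conclusion_unique X hX
    exact ⟨_, Finset.mem_image_of_mem _ hL, by simp [Link.verts_toCell, hXL]⟩

/-- The removed link `L` already uses `X`, and an occurrence is a premise of one link at most. -/
theorem isExit_skel {Θ Θ' : ProofStructure} {X : Occ} {L : Link} (hX : X ∈ Θ'.forms)
    (hXΘ : X ∈ Θ.forms) (hL : L ∈ Θ.links) (hXL : X ∈ L.premises) (hsub : Θ'.links ⊆ Θ.links)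
    (hL' : L ∉ Θ'.links) : IsExit Θ'.skel X := by
  refine ⟨by rwa [vertices_skel], ?_⟩
  intro M hM hXM
  obtain ⟨M, hM', rfl⟩ := Finset.mem_image.1 hM
  rw [Link.prems_toCell] at hXM
  exact hL' (Θ.premise_unique X hXΘ L hL M (hsub hM') hXL hXM ▸ hM')

theorem Sequentializable.seq {Θ : ProofStructure} (h : Θ.Sequentializable) :
    Seq mainConn Θ.skel := by
  induction h with
  | ident Θ i j hL =>
    simp only [skel, hL, Finset.image_singleton]
    exact .ident _ _ (by simp)
  | par Θ Θ₀ X Y k hL hc hforms hlinks h₀ ih =>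
    have e : Θ.skel = insert (Cell.mult X Y (multConcl .par X Y k)) Θ₀.skel := by
      unfold skel
      rw [hlinks]
      conv_lhs => rw [← Finset.insert_erase hL, Finset.image_insert]
      rfl
    have hsub : Θ₀.links ⊆ Θ.links := hlinks ▸ Finset.erase_subset _ _
    have hLn : Link.mult Conn.par X Y k ∉ Θ₀.links := by simp [hlinks]
    have hex : ∀ Z, Z ∈ (Link.mult Conn.par X Y k).premises → IsExit Θ₀.skel Z := by
      intro Z hZ
      have hZΘ := Θ.premises_subset _ hL hZ
      refine isExit_skel ?_ hZΘ hL hZ hsub hLn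
      rw [hforms]
      exact Finset.mem_erase.2 ⟨fun e => hc.2 _ hL (e ▸ hZ), hZΘ⟩
    rw [e]
    exact .par _ _ _ _ ih (hex X (by simp [Link.premises])) (hex Y (by simp [Link.premises]))
      (Θ.premises_ne _ _ _ _ hL) (by simp [vertices_skel, hforms]) rfl
  | tensor Θ Θ₁ Θ₂ X Y k hL hc hX hY hforms hforms_disj hforms_notMem hlinks hlinks_disj
      hlinks_notMem h₁ h₂ ih₁ ih₂ =>
    have e : Θ.skel = insert (Cell.mult X Y (multConcl .tensor X Y k)) (Θ₁.skel ∪ Θ₂.skel) := by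
      unfold skel
      rw [hlinks, Finset.image_insert, Finset.image_union]
      rfl
    rw [Finset.mem_union, not_or] at hforms_notMem hlinks_notMem
    have hXL : X ∈ (Link.mult Conn.tensor X Y k).premises := by simp [Link.premises]
    have hYL : Y ∈ (Link.mult Conn.tensor X Y k).premises := by simp [Link.premises]
    rw [e]
    refine .tensor _ _ _ _ _ ih₁ ih₂ (by simpa [vertices_skel] using hforms_disj) (.inl ⟨?_, ?_⟩)
      (by simpa [vertices_skel] using hforms_notMem.1)
      (by simpa [vertices_skel] using hforms_notMem.2) rfl
    · exact isExit_skel hX (Θ.premises_subset _ hL hXL) hL hXL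
        (by rw [hlinks]; intro L; simp; tauto) hlinks_notMem.1
    · exact isExit_skel hY (Θ.premises_subset _ hL hYL) hL hYL
        (by rw [hlinks]; intro L; simp; tauto) hlinks_notMem.2

/-- The proof structure on a set of links that contains with each link the links above it. -/
def restrict (Θ : ProofStructure) (M : Finset Link) (hM : M ⊆ Θ.links)
    (hprem : ∀ L ∈ M, L.premises ⊆ M.biUnion Link.conclusions) : ProofStructure where
  forms := M.biUnion Link.conclusions
  links := M
  premises_subset := hprem
  conclusions_subset := fun _ hL => Finset.subset_biUnion_of_mem Link.conclusions hL
  index_unique X hX Y hY := Θ.index_unique X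
    (Finset.biUnion_subset.2 (fun L hL => Θ.conclusions_subset L (hM hL)) hX) Y
    (Finset.biUnion_subset.2 (fun L hL => Θ.conclusions_subset L (hM hL)) hY)
  premise_unique X hX L hL L' hL' := Θ.premise_unique X
    (Finset.biUnion_subset.2 (fun L hL => Θ.conclusions_subset L (hM hL)) hX) L (hM hL) L' (hM hL')
  premises_ne c X Y k h := Θ.premises_ne c X Y k (hM h)
  conclusion_unique X hX := by
    obtain ⟨L, hL, hXL⟩ := Finset.mem_biUnion.1 hX
    refine ⟨L, ⟨hL, hXL⟩, fun L' h => ?_⟩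
    exact (Θ.conclusion_unique X (Θ.conclusions_subset L (hM hL) hXL)).unique ⟨hM h.1, h.2⟩
      ⟨hM hL, hXL⟩

theorem exists_restrict {Θ : ProofStructure} {σ : Occ → Conn} {S : Finset (Cell Occ)}
    (hS : Seq σ S) (hsub : S ⊆ Θ.skel) :
    ∃ Θ₀ : ProofStructure, Θ₀.skel = S := by
  have hcells : (Θ.links.filter (fun L => L.toCell ∈ S)).image Link.toCell = S := by
    ext C
    simp only [Finset.mem_image, Finset.mem_filter]
    constructor
    · rintro ⟨L, ⟨-, h⟩, rfl⟩
      exact h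
    · intro hC
      obtain ⟨L, hL, rfl⟩ := Finset.mem_image.1 (hsub hC)
      exact ⟨L, ⟨hL, hC⟩, rfl⟩
  refine ⟨Θ.restrict _ (Finset.filter_subset _ _) ?_, hcells⟩
  intro L hL X hX
  have hXS : X ∈ vertices S := mem_vertices.2 ⟨_, (Finset.mem_filter.1 hL).2, by
    simp [Link.verts_toCell, hX]⟩
  obtain ⟨C, hC, hXC, hXC'⟩ := hS.exists_concl X hXS
  rw [← hcells] at hC
  obtain ⟨M, hM, rfl⟩ := Finset.mem_image.1 hC
  rw [Link.verts_toCell, Finset.mem_union] at hXC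
  rw [Link.prems_toCell] at hXC'
  exact Finset.mem_biUnion.2 ⟨M, hM, by tauto⟩

theorem exists_mult_link {Θ : ProofStructure} {a b c : Occ} (h : Cell.mult a b c ∈ Θ.skel) :
    ∃ k, Link.mult (mainConn c) a b k ∈ Θ.links ∧ c = multConcl (mainConn c) a b k := by
  obtain ⟨L, hL, e⟩ := Finset.mem_image.1 h
  cases L with
  | ident i j => simp [Link.toCell] at e
  | mult d X Y k =>
    simp only [Link.toCell, Cell.mult.injEq] at e
    obtain ⟨rfl, rfl, rfl⟩ := e
    rw [mainConn_multConcl]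
    exact ⟨k, hL, rfl⟩

theorem exists_ident_link {Θ : ProofStructure} {a b : Occ} (h : Cell.ident a b ∈ Θ.skel) :
    ∃ i j, Link.ident i j ∈ Θ.links ∧ a = (Formula.pos, i) ∧ b = (Formula.neg, j) := by
  obtain ⟨L, hL, e⟩ := Finset.mem_image.1 h
  cases L with
  | ident i j =>
    simp only [Link.toCell, Cell.ident.injEq] at e
    exact ⟨i, j, hL, e.1.symm, e.2.symm⟩
  | mult d X Y k => simp [Link.toCell] at e

theorem links_eq_of_skel_eq {Θ : ProofStructure} {M : Finset Link}
    (h : Θ.skel = M.image Link.toCell) : Θ.links = M :=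
  Finset.image_injective Link.toCell_injective h

/-- The parts of a sequentialization are realized as sub-structures of `Θ` by `exists_restrict`. The
⊗ clause wants the left premise in the first structure, so the parts are swapped when `Joins` holds
the other way round. -/
theorem sequentializable_of_seq {σ : Occ → Conn} {S : Finset (Cell Occ)} (h : Seq σ S) :
    ∀ Θ : ProofStructure, Θ.skel = S → (∀ x, IsNode S x → σ x = mainConn x) →
      Θ.Sequentializable := by
  induction h with
  | ident a b hab =>
    intro Θ e _
    obtain ⟨i, j, -, rfl, rfl⟩ := Θ.exists_ident_link (a := a) (b := b) (by simp [e])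
    refine .ident Θ i j (links_eq_of_skel_eq ?_)
    rw [e, Finset.image_singleton]
    rfl
  | par S a b c hS ha hb hab hc hσ ih =>
    intro Θ e hlab
    obtain ⟨k, hL, hck⟩ := Θ.exists_mult_link (a := a) (b := b) (c := c) (by simp [e])
    have hpar : mainConn c = Conn.par := by rw [← hlab c (isNode_insert.2 (.inl rfl)), hσ]
    rw [hpar] at hL hck
    obtain ⟨Θ₀, h2⟩ := exists_restrict (Θ := Θ) hS (by rw [e]; exact Finset.subset_insert _ _)
    have hv : vertices (insert (Cell.mult a b c) S) = insert c (vertices S) := by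
      ext x
      have := ha.1
      have := hb.1
      grind
    have hforms : Θ.forms = insert c Θ₀.forms := by
      rw [← vertices_skel, ← vertices_skel, e, h2, hv]
    have hlinks : Θ.links = insert (Link.mult Conn.par a b k) Θ₀.links := by
      apply links_eq_of_skel_eq
      rw [Finset.image_insert]
      change _ = insert _ Θ₀.skel
      rw [e, h2, hck]
      rfl
    have hcΘ : c ∉ Θ₀.forms := by rwa [← vertices_skel, h2]
    have hLn : Link.mult Conn.par a b k ∉ Θ₀.links := fun h =>
      hcΘ (Θ₀.conclusions_subset _ h (by simp [Link.conclusions, ← hck]))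
    refine .par Θ Θ₀ a b k hL ⟨?_, ?_⟩ ?_ ?_ (ih Θ₀ h2 fun x hx =>
      hlab x (isNode_insert.2 (.inr hx)))
    · rw [← hck, hforms]
      exact Finset.mem_insert_self _ _
    · intro L hL' h
      rw [← hck] at h
      rw [hlinks] at hL'
      rcases Finset.mem_insert.1 hL' with rfl | hL'
      · simp only [Link.premises, Finset.mem_insert, Finset.mem_singleton] at h
        rcases h with rfl | rfl
        · exact hc ha.1
        · exact hc hb.1
      · exact hcΘ (Θ₀.premises_subset L hL' h)
    · rw [← hck, hforms, Finset.erase_insert hcΘ]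
    · rw [hlinks, Finset.erase_insert hLn]
  | tensor S T a b c hS hT hd hj hcS hcT hσ ihS ihT =>
    intro Θ e hlab
    obtain ⟨k, hL, hck⟩ := Θ.exists_mult_link (a := a) (b := b) (c := c) (by simp [e])
    have htens : mainConn c = Conn.tensor := by rw [← hlab c (isNode_insert.2 (.inl rfl)), hσ]
    rw [htens] at hL hck
    have key : ∀ (Θ₁ Θ₂ : ProofStructure), Θ₁.Sequentializable → Θ₂.Sequentializable →
        Θ.skel = insert (Cell.mult a b c) (Θ₁.skel ∪ Θ₂.skel) → Disjoint Θ₁.forms Θ₂.forms →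
        c ∉ Θ₁.forms → c ∉ Θ₂.forms → a ∈ Θ₁.forms → b ∈ Θ₂.forms → Θ.Sequentializable := by
      intro Θ₁ Θ₂ h1 h2 e hd hc1 hc2 ha hb
      have hv : Θ.forms = insert c (Θ₁.forms ∪ Θ₂.forms) := by
        rw [← vertices_skel, e]
        rw [← vertices_skel] at ha hb ⊢
        rw [← vertices_skel, ← vertices_union]
        have ha' : a ∈ vertices (Θ₁.skel ∪ Θ₂.skel) := by simp [vertices_union, ha]
        have hb' : b ∈ vertices (Θ₁.skel ∪ Θ₂.skel) := by simp [vertices_union, hb]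
        generalize Θ₁.skel ∪ Θ₂.skel = R at ha' hb'
        ext x
        clear e hlab hd
        grind
      have hlinks : Θ.links = insert (Link.mult Conn.tensor a b k) (Θ₁.links ∪ Θ₂.links) := by
        apply links_eq_of_skel_eq
        rw [Finset.image_insert, Finset.image_union]
        change _ = insert _ (Θ₁.skel ∪ Θ₂.skel)
        rw [e, hck]
        rfl
      have hn : ∀ Θ' : ProofStructure, c ∉ Θ'.forms → Link.mult Conn.tensor a b k ∉ Θ'.links :=
        fun Θ' hc h => hc (Θ'.conclusions_subset _ h (by simp [Link.conclusions, ← hck]))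
      refine .tensor Θ Θ₁ Θ₂ a b k hL ⟨?_, ?_⟩ ha hb (hck ▸ hv) hd ?_ hlinks ?_ ?_ h1 h2
      · rw [← hck, hv]
        exact Finset.mem_insert_self _ _
      · intro L hL' h
        rw [← hck] at h
        rw [hlinks, Finset.mem_insert, Finset.mem_union] at hL'
        rcases hL' with rfl | hL' | hL'
        · simp only [Link.premises, Finset.mem_insert, Finset.mem_singleton] at h
          rcases h with rfl | rfl <;> contradiction
        · exact hc1 (Θ₁.premises_subset L hL' h)
        · exact hc2 (Θ₂.premises_subset L hL' h)
      · rw [← hck, Finset.mem_union]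
        tauto
      · rw [Finset.disjoint_left]
        intro L h1 h2
        obtain ⟨x, hx⟩ : ∃ x, x ∈ L.conclusions := by
          cases L <;> simp [Link.conclusions]
        exact Finset.disjoint_left.1 hd (Θ₁.conclusions_subset L h1 hx)
          (Θ₂.conclusions_subset L h2 hx)
      · rw [Finset.mem_union]
        rintro (h | h)
        · exact hn _ hc1 h
        · exact hn _ hc2 h
    obtain ⟨Θ₁, h1⟩ := exists_restrict (Θ := Θ) hS (by rw [e]; intro L hL; simp [hL])
    obtain ⟨Θ₂, h2⟩ := exists_restrict (Θ := Θ) hT (by rw [e]; intro L hL; simp [hL])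
    have s1 := ihS Θ₁ h1 fun x hx => hlab x (isNode_insert.2 (.inr (isNode_union.2 (.inl hx))))
    have s2 := ihT Θ₂ h2 fun x hx => hlab x (isNode_insert.2 (.inr (isNode_union.2 (.inr hx))))
    have v1 : Θ₁.forms = vertices S := by rw [← vertices_skel, h1]
    have v2 : Θ₂.forms = vertices T := by rw [← vertices_skel, h2]
    rcases hj with ⟨h, h'⟩ | ⟨h, h'⟩
    · exact key Θ₁ Θ₂ s1 s2 (by rw [e, h1, h2]) (by rwa [v1, v2]) (by rwa [v1]) (by rwa [v2])
        (v1 ▸ h.1) (v2 ▸ h'.1)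
    · exact key Θ₂ Θ₁ s2 s1 (by rw [e, h1, h2, Finset.union_comm]) (by rw [v1, v2]; exact hd.symm)
        (by rwa [v2]) (by rwa [v1]) (v2 ▸ h.1) (v1 ▸ h'.1)

theorem isProofNet_iff_seq (Θ : ProofStructure) : Θ.IsProofNet ↔ Seq mainConn Θ.skel :=
  ⟨fun h => Sequentializable.seq h, fun h => sequentializable_of_seq h Θ rfl fun _ _ => rfl⟩

end ProofStructure
-- Graph isomorphisms act on skeletons
/-- The labelled edges of a cell. -/
def Cell.edges {α : Type} [DecidableEq α] : Cell α → Finset (α × ELabel × α)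
  | .ident a b => {(a, ELabel.ident, b)}
  | .mult a b c => {(a, ELabel.left, c), (b, ELabel.right, c)}

theorem Link.edges_toCell (L : Link) : L.toCell.edges = L.edges := by
  cases L <;> rfl

theorem Cell.edges_map {α β : Type} [DecidableEq α] [DecidableEq β] (f : α → β) (C : Cell α) :
    (C.map f).edges = C.edges.image (fun e => (f e.1, e.2.1, f e.2.2)) := by
  cases C <;> simp [Cell.map, Cell.edges, Finset.image_insert]

/-- The label of a multiplicative vertex. -/
def Conn.vlabel : Conn → VLabel
  | .tensor => .tensor
  | .par => .par

theorem Conn.vlabel_injective : Function.Injective Conn.vlabel := by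
  intro c d h
  cases c <;> cases d <;> simp_all [Conn.vlabel]

theorem strip_multConcl (c : Conn) (X Y : Occ) (k : ℕ) :
    strip (multConcl c X Y k).1 = c.vlabel := by
  cases c <;> rfl

namespace ProofStructure

theorem exists_edge_iff (Θ : ProofStructure) (e : Occ × ELabel × Occ) :
    (∃ L ∈ Θ.links, e ∈ L.edges) ↔ ∃ C ∈ Θ.skel, e ∈ C.edges := by
  simp only [skel, Finset.mem_image, exists_exists_and_eq_and, Link.edges_toCell]

theorem link_eq_of_conclusion {Θ : ProofStructure} {L M : Link} (hL : L ∈ Θ.links)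
    (hM : M ∈ Θ.links) {X : Occ} (hXL : X ∈ L.conclusions) (hXM : X ∈ M.conclusions) : L = M :=
  (Θ.conclusion_unique X (Θ.conclusions_subset L hL hXL)).unique ⟨hL, hXL⟩ ⟨hM, hXM⟩

theorem ident_mem_skel_iff (Θ : ProofStructure) (a b : Occ) :
    Cell.ident a b ∈ Θ.skel ↔ ∃ L ∈ Θ.links, (a, ELabel.ident, b) ∈ L.edges := by
  rw [exists_edge_iff]
  constructor
  · exact fun h => ⟨_, h, by simp [Cell.edges]⟩
  · rintro ⟨C, hC, h⟩
    cases C with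
    | ident x y =>
      simp only [Cell.edges, Finset.mem_singleton, Prod.mk.injEq, true_and] at h
      rwa [h.1, h.2]
    | mult x y z => simp [Cell.edges] at h

/-- An L-edge and an R-edge with the same target come from the same link, since an occurrence is the
conclusion of only one link. -/
theorem mult_mem_skel_iff (Θ : ProofStructure) (a b c : Occ) :
    Cell.mult a b c ∈ Θ.skel ↔ (∃ L ∈ Θ.links, (a, ELabel.left, c) ∈ L.edges) ∧
      ∃ L ∈ Θ.links, (b, ELabel.right, c) ∈ L.edges := by
  rw [exists_edge_iff, exists_edge_iff]
  constructor
  · exact fun h => ⟨⟨_, h, by simp [Cell.edges]⟩, ⟨_, h, by simp [Cell.edges]⟩⟩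
  · rintro ⟨⟨C, hC, h⟩, ⟨D, hD, h'⟩⟩
    obtain ⟨L, hL, rfl⟩ := Finset.mem_image.1 hC
    obtain ⟨M, hM, rfl⟩ := Finset.mem_image.1 hD
    cases L with
    | ident i j => simp [Cell.edges, Link.toCell] at h
    | mult d X Y k =>
      cases M with
      | ident i j => simp [Cell.edges, Link.toCell] at h'
      | mult d' X' Y' k' =>
        simp only [Cell.edges, Link.toCell, Finset.mem_insert, Finset.mem_singleton,
          Prod.mk.injEq, true_and, false_and, or_false, false_or, reduceCtorEq, and_false] at h h'
        obtain ⟨rfl, hc⟩ := h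
        obtain ⟨rfl, hc'⟩ := h'
        have := link_eq_of_conclusion hL hM (X := c) (by simp [Link.conclusions, hc])
          (by simp [Link.conclusions, hc'])
        injection this with _ _ e _
        rw [hc, ← e]
        exact hC

/-- The action of an isomorphism on formula occurrences. -/
def occMap {Θ₁ Θ₂ : ProofStructure} (h : GraphIso Θ₁.graph Θ₂.graph) (X : Occ) : Occ :=
  if hX : X ∈ Θ₁.forms then (h.hV ⟨X, hX⟩).1 else X

theorem occMap_of_mem {Θ₁ Θ₂ : ProofStructure} (h : GraphIso Θ₁.graph Θ₂.graph) {X : Occ}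
    (hX : X ∈ Θ₁.forms) : occMap h X = (h.hV ⟨X, hX⟩).1 := by
  simp [occMap, hX]

theorem occMap_injOn {Θ₁ Θ₂ : ProofStructure} (h : GraphIso Θ₁.graph Θ₂.graph) :
    Set.InjOn (occMap h) (vertices Θ₁.skel) := by
  rw [vertices_skel]
  intro X hX Y hY e
  rw [occMap_of_mem h hX, occMap_of_mem h hY] at e
  exact congrArg Subtype.val (h.hV.injective (Subtype.ext e))

theorem edge_occMap {Θ₁ Θ₂ : ProofStructure} (h : GraphIso Θ₁.graph Θ₂.graph)
    {e : Occ × ELabel × Occ} (he : ∃ L ∈ Θ₁.links, e ∈ L.edges) :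
    ∃ L ∈ Θ₂.links, (occMap h e.1, e.2.1, occMap h e.2.2) ∈ L.edges := by
  have h1 := h.src_comm ⟨e, he⟩
  have h2 := h.tgt_comm ⟨e, he⟩
  have h3 := h.edgeLabel_comm ⟨e, he⟩
  obtain ⟨L, hL, hmem⟩ := (h.hE ⟨e, he⟩).2
  refine ⟨L, hL, ?_⟩
  convert hmem using 1
  have hm := Θ₁.edge_mem_forms e he
  rw [occMap_of_mem h hm.1, occMap_of_mem h hm.2]
  exact Prod.ext (congrArg Subtype.val h1) (Prod.ext h3 (congrArg Subtype.val h2))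

theorem map_mem_skel {Θ₁ Θ₂ : ProofStructure} (h : GraphIso Θ₁.graph Θ₂.graph) {C : Cell Occ}
    (hC : C ∈ Θ₁.skel) : C.map (occMap h) ∈ Θ₂.skel := by
  cases C with
  | ident a b =>
    rw [ident_mem_skel_iff] at hC
    exact (ident_mem_skel_iff _ _ _).2 (edge_occMap h hC)
  | mult a b c =>
    rw [mult_mem_skel_iff] at hC
    exact (mult_mem_skel_iff _ _ _ _).2 ⟨edge_occMap h hC.1, edge_occMap h hC.2⟩

theorem occMap_symm {Θ₁ Θ₂ : ProofStructure} (h : GraphIso Θ₁.graph Θ₂.graph) {X : Occ}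
    (hX : X ∈ Θ₂.forms) : occMap h (occMap h.symm X) = X := by
  rw [occMap_of_mem h.symm hX, occMap_of_mem h (h.symm.hV ⟨X, hX⟩).2]
  exact congrArg Subtype.val (h.hV.apply_symm_apply ⟨X, hX⟩)

/-- Cells are recoverable from labelled edges, so an isomorphism and its inverse both carry cells to
cells. -/
theorem skel_eq_image {Θ₁ Θ₂ : ProofStructure} (h : GraphIso Θ₁.graph Θ₂.graph) :
    Θ₂.skel = Θ₁.skel.image (Cell.map (occMap h)) := by
  ext C
  rw [Finset.mem_image]
  constructor
  · intro hC
    refine ⟨_, map_mem_skel h.symm hC, ?_⟩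
    rw [Cell.map_map]
    conv_rhs => rw [← Cell.map_id C]
    refine Cell.map_congr fun x hx => occMap_symm h ?_
    rw [← vertices_skel]
    exact mem_vertices.2 ⟨C, hC, hx⟩
  · rintro ⟨C, hC, rfl⟩
    exact map_mem_skel h hC

theorem isProofNet_iff_of_iso {Θ₁ Θ₂ : ProofStructure} (h : GraphIso Θ₁.graph Θ₂.graph) :
    Θ₂.IsProofNet ↔ Seq (fun X => mainConn (occMap h X)) Θ₁.skel := by
  have : Nonempty Occ := ⟨(Formula.pos, 0)⟩
  rw [isProofNet_iff_seq, skel_eq_image h, seq_image_iff (occMap_injOn h)]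

theorem strip_occMap_of_isNode {Θ₁ Θ₂ : ProofStructure} (h : GraphIso Θ₁.graph Θ₂.graph) {X : Occ}
    (hX : IsNode Θ₁.skel X) : strip (occMap h X).1 = (mainConn (occMap h X)).vlabel := by
  obtain ⟨a, b, hX⟩ := hX
  obtain ⟨k, -, e⟩ := exists_mult_link (map_mem_skel h hX)
  conv_lhs => rw [e]
  exact strip_multConcl _ _ _ _

/-- Such a vertex is an end of an ID-edge, and the direction of the edge, which isomorphisms keep,
distinguishes the two literals. -/
theorem strip_occMap_of_not_isNode {Θ₁ Θ₂ : ProofStructure} (h : GraphIso Θ₁.graph Θ₂.graph)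
    {X : Occ} (hX : X ∈ Θ₁.forms) (hn : ¬ IsNode Θ₁.skel X) :
    strip (occMap h X).1 = strip X.1 := by
  obtain ⟨L, ⟨hL, hXL⟩, -⟩ := Θ₁.conclusion_unique X hX
  have hC : L.toCell ∈ Θ₁.skel := Finset.mem_image_of_mem _ hL
  cases L with
  | ident i j =>
    obtain ⟨i', j', -, e, e'⟩ := exists_ident_link (map_mem_skel h hC)
    simp only [Link.conclusions, Finset.mem_insert, Finset.mem_singleton] at hXL
    rcases hXL with rfl | rfl
    · rw [e]
    · rw [e']
  | mult c Y Z k =>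
    simp only [Link.conclusions, Finset.mem_singleton] at hXL
    exact absurd ⟨Y, Z, hXL ▸ hC⟩ hn

/-! ### Mismatches and distances -/

/-- The mismatches of two isomorphic images of `Θ` are counted by the nodes of `Θ`. -/
theorem mismatches_symm_trans {Θ Θ₁ Θ₂ : ProofStructure} (h₁ : GraphIso Θ.graph Θ₁.graph)
    (h₂ : GraphIso Θ.graph Θ₂.graph) :
    mismatches (h₁.symm.trans h₂) = Set.ncard {X : Occ | IsNode Θ.skel X ∧
      mainConn (occMap h₁ X) ≠ mainConn (occMap h₂ X)} := by
  have hform : ∀ {X}, IsNode Θ.skel X → X ∈ Θ.forms := fun h => vertices_skel Θ ▸ h.mem_vertices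
  have key : ∀ v : Θ.graph.V, (Θ₂.vgraph strip).vertexLabel ((h₁.symm.trans h₂).hV (h₁.hV v)) ≠
      (Θ₁.vgraph strip).vertexLabel (h₁.hV v) ↔
      strip (occMap h₂ v.1).1 ≠ strip (occMap h₁ v.1).1 := by
    intro v
    rw [show (h₁.symm.trans h₂).hV (h₁.hV v) = h₂.hV v from
      congrArg h₂.hV (h₁.hV.symm_apply_apply v), occMap_of_mem h₁ v.2, occMap_of_mem h₂ v.2]
    rfl
  symm
  unfold mismatches
  refine Set.ncard_congr (fun X hX => h₁.hV ⟨X, hform hX.1⟩) ?_ ?_ ?_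
  · rintro X ⟨hX, hne⟩
    refine (key ⟨X, hform hX⟩).2 ?_
    rw [strip_occMap_of_isNode _ hX, strip_occMap_of_isNode _ hX]
    exact fun h => hne (Conn.vlabel_injective h).symm
  · intro X Y hX hY e
    exact congrArg Subtype.val (h₁.hV.injective e)
  · intro v hv
    obtain ⟨⟨X, hX⟩, rfl⟩ := h₁.hV.surjective v
    have hv := (key ⟨X, hX⟩).1 hv
    by_cases hn : IsNode Θ.skel X
    · refine ⟨X, ⟨hn, fun e => hv ?_⟩, rfl⟩
      rw [strip_occMap_of_isNode _ hn, strip_occMap_of_isNode _ hn, e]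
    · exact absurd (by rw [strip_occMap_of_not_isNode _ hX hn, strip_occMap_of_not_isNode _ hX hn])
        hv

theorem mismatches_eq {Θ Θ' : ProofStructure} (h : GraphIso Θ.graph Θ'.graph) :
    mismatches h = Set.ncard {X : Occ | IsNode Θ.skel X ∧
      mainConn X ≠ mainConn (occMap h X)} := by
  have e := mismatches_symm_trans (GraphIso.refl Θ.graph) h
  have e' : (GraphIso.refl Θ.graph).symm.trans h = h := rfl
  rw [e'] at e
  rw [e]
  congr 1
  ext X
  refine and_congr_right fun hX => ?_
  rw [occMap_of_mem (GraphIso.refl _) (vertices_skel Θ ▸ hX.mem_vertices)]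
  rfl

theorem finite_isNode (Θ : ProofStructure) (p : Occ → Prop) :
    {X : Occ | IsNode Θ.skel X ∧ p X}.Finite :=
  (vertices Θ.skel).finite_toSet.subset fun _ hX => hX.1.mem_vertices

/-- An isomorphism between proof nets does not change exactly one label. -/
theorem mismatches_ne_one {Θ Θ' : ProofStructure} (hΘ : Θ.IsProofNet) (hΘ' : Θ'.IsProofNet)
    (h : GraphIso Θ.graph Θ'.graph) : mismatches h ≠ 1 := by
  rw [mismatches_eq]
  intro e
  obtain ⟨p, hp⟩ := Set.ncard_eq_one.1 e
  have hmem : p ∈ {X : Occ | IsNode Θ.skel X ∧ mainConn X ≠ mainConn (occMap h X)} := by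
    rw [hp]; rfl
  refine ((isProofNet_iff_seq Θ).1 hΘ).not_differ_once ((isProofNet_iff_of_iso h).1 hΘ') hmem.1
    hmem.2 fun x hx hxp => ?_
  by_contra hne
  have : x ∈ {X : Occ | IsNode Θ.skel X ∧ mainConn X ≠ mainConn (occMap h X)} := ⟨hx, hne⟩
  rw [hp] at this
  exact hxp this

theorem same_of_mismatches_eq_zero {Θ Θ' : ProofStructure} (h : GraphIso Θ.graph Θ'.graph)
    (h0 : mismatches h = 0) : Θ.Same Θ' := by
  have : Finite (Θ.vgraph strip).V := inferInstanceAs (Finite {X : Occ // X ∈ Θ.forms})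
  have he := (Set.ncard_eq_zero (Set.toFinite _)).1 h0
  refine ⟨⟨h, fun v => ?_⟩⟩
  by_contra hv
  exact (Set.eq_empty_iff_forall_notMem.1 he v) fun e => hv e.symm

theorem isProofNet_of_mismatches_eq_zero {Θ Θ' : ProofStructure} (h : GraphIso Θ.graph Θ'.graph)
    (h0 : mismatches h = 0) (hΘ' : Θ'.IsProofNet) : Θ.IsProofNet := by
  rw [mismatches_eq, Set.ncard_eq_zero (finite_isNode _ _)] at h0
  rw [isProofNet_iff_seq]
  refine ((isProofNet_iff_of_iso h).1 hΘ').congr fun X hX => ?_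
  by_contra hne
  exact (Set.eq_empty_iff_forall_notMem.1 h0 X) ⟨hX, fun e => hne e.symm⟩

theorem Same.symm {Θ Θ' : ProofStructure} (h : Θ.Same Θ') : Θ'.Same Θ := by
  obtain ⟨h⟩ := h
  refine ⟨⟨h.toGraphIso.symm, fun v => ?_⟩⟩
  have := h.vertexLabel_comm (h.hV.symm v)
  rw [Equiv.apply_symm_apply] at this
  exact this.symm

theorem Same.trans {Θ Θ' Θ'' : ProofStructure} (h : Θ.Same Θ') (h' : Θ'.Same Θ'') :
    Θ.Same Θ'' := by
  obtain ⟨h⟩ := h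
  obtain ⟨h'⟩ := h'
  exact ⟨⟨h.toGraphIso.trans h'.toGraphIso, fun v =>
    (h.vertexLabel_comm v).trans (h'.vertexLabel_comm _)⟩⟩

theorem exists_mismatches_eq_psDist {Θ Θ' : ProofStructure} (h : Θ.Related Θ') :
    ∃ g : GraphIso Θ.graph Θ'.graph, mismatches g = psDist Θ Θ' := by
  obtain ⟨h⟩ := h
  exact Nat.sInf_mem (s := {n | ∃ h : GraphIso Θ.graph Θ'.graph, mismatches h = n}) ⟨_, h, rfl⟩

theorem psDist_le {Θ Θ' : ProofStructure} (h : GraphIso Θ.graph Θ'.graph) :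
    psDist Θ Θ' ≤ mismatches h :=
  Nat.sInf_le ⟨h, rfl⟩

theorem two_le_psDist {Θ Θ' : ProofStructure} (hΘ : Θ.IsProofNet) (hΘ' : Θ'.IsProofNet)
    (hr : Θ.Related Θ') (hne : ¬ Θ.Same Θ') : 2 ≤ psDist Θ Θ' := by
  obtain ⟨g, hg⟩ := exists_mismatches_eq_psDist hr
  have h0 : psDist Θ Θ' ≠ 0 := fun e => hne (same_of_mismatches_eq_zero g (hg.trans e))
  have h1 : psDist Θ Θ' ≠ 1 := fun e => mismatches_ne_one hΘ hΘ' g (hg.trans e)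
  omega

/-! ### Changing the connectives of a proof structure -/

open Classical in
/-- The indices of the left and the right premise of the link with conclusion index `k`. -/
noncomputable def premiseIndices (Θ : ProofStructure) (k : ℕ) : ℕ × ℕ :=
  if h : ∃ p : ℕ × ℕ, ∃ c A B, Link.mult c (A, p.1) (B, p.2) k ∈ Θ.links then h.choose else (0, 0)

/-- An index determines its occurrence and an occurrence its link, so the choice is forced and the
default pair is not used. These indices let `relabelFormula` descend through a formula while
tracking which occurrence each subformula belongs to. -/
theorem premiseIndices_eq {Θ : ProofStructure} {c : Conn} {X Y : Occ} {k : ℕ}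
    (h : Link.mult c X Y k ∈ Θ.links) : Θ.premiseIndices k = (X.2, Y.2) := by
  have hex : ∃ p : ℕ × ℕ, ∃ c A B, Link.mult c (A, p.1) (B, p.2) k ∈ Θ.links :=
    ⟨(X.2, Y.2), c, X.1, Y.1, h⟩
  rw [premiseIndices, dif_pos hex]
  obtain ⟨d, A, B, h'⟩ := hex.choose_spec
  have m1 : multConcl c X Y k ∈ (Link.mult c X Y k).conclusions := by simp [Link.conclusions]
  have m2 : multConcl d (A, hex.choose.1) (B, hex.choose.2) k ∈
      (Link.mult d (A, hex.choose.1) (B, hex.choose.2) k).conclusions := by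
    simp [Link.conclusions]
  have e := Θ.index_unique _ (Θ.conclusions_subset _ h m1) _ (Θ.conclusions_subset _ h' m2) rfl
  have e' : multConcl c X Y k = multConcl d (A, hex.choose.1) (B, hex.choose.2) k :=
    Prod.ext e rfl
  have := link_eq_of_conclusion h h' m1 (e' ▸ m2)
  injection this with _ e1 e2 _
  rw [e1, e2]

/-- The formula `A` of the occurrence with index `k`, with the connectives changed as told
by `τ`. -/
noncomputable def relabelFormula (Θ : ProofStructure) (τ : Occ → Conn) : Formula → ℕ → Formula
  | .pos, _ => .pos
  | .neg, _ => .neg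
  | .tensor A B, k => (τ (.tensor A B, k)).formula
      (relabelFormula Θ τ A (Θ.premiseIndices k).1) (relabelFormula Θ τ B (Θ.premiseIndices k).2)
  | .par A B, k => (τ (.par A B, k)).formula
      (relabelFormula Θ τ A (Θ.premiseIndices k).1) (relabelFormula Θ τ B (Θ.premiseIndices k).2)

/-- The relabelled occurrence. -/
noncomputable def relabelOcc (Θ : ProofStructure) (τ : Occ → Conn) (X : Occ) : Occ :=
  (relabelFormula Θ τ X.1 X.2, X.2)

/-- The relabelled link. -/
noncomputable def relabelLink (Θ : ProofStructure) (τ : Occ → Conn) : Link → Link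
  | .ident i j => .ident i j
  | .mult c X Y k => .mult (τ (multConcl c X Y k)) (Θ.relabelOcc τ X) (Θ.relabelOcc τ Y) k

theorem relabelOcc_multConcl {Θ : ProofStructure} (τ : Occ → Conn) {c : Conn} {X Y : Occ} {k : ℕ}
    (h : Link.mult c X Y k ∈ Θ.links) : Θ.relabelOcc τ (multConcl c X Y k) =
      multConcl (τ (multConcl c X Y k)) (Θ.relabelOcc τ X) (Θ.relabelOcc τ Y) k := by
  have e := premiseIndices_eq h
  cases c <;>
    simp [relabelOcc, multConcl, Conn.formula, relabelFormula, e]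

theorem relabelLink_premises (Θ : ProofStructure) (τ : Occ → Conn) (L : Link) :
    (Θ.relabelLink τ L).premises = L.premises.image (Θ.relabelOcc τ) := by
  cases L <;> simp [relabelLink, Link.premises, Finset.image_insert]

theorem relabelLink_conclusions {Θ : ProofStructure} (τ : Occ → Conn) {L : Link}
    (hL : L ∈ Θ.links) :
    (Θ.relabelLink τ L).conclusions = L.conclusions.image (Θ.relabelOcc τ) := by
  cases L with
  | ident i j =>
    simp [relabelLink, Link.conclusions, Finset.image_insert, relabelOcc, relabelFormula]
  | mult c X Y k => simp [relabelLink, Link.conclusions, relabelOcc_multConcl τ hL]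

theorem toCell_relabelLink {Θ : ProofStructure} (τ : Occ → Conn) {L : Link} (hL : L ∈ Θ.links) :
    (Θ.relabelLink τ L).toCell = L.toCell.map (Θ.relabelOcc τ) := by
  cases L with
  | ident i j => rfl
  | mult c X Y k =>
    simp [relabelLink, Link.toCell, Cell.map, relabelOcc_multConcl τ hL]

theorem relabelOcc_injOn (Θ : ProofStructure) (τ : Occ → Conn) {X Y : Occ} (hX : X ∈ Θ.forms)
    (hY : Y ∈ Θ.forms) (h : Θ.relabelOcc τ X = Θ.relabelOcc τ Y) : X = Y := by
  -- Relabelling keeps indices, and indices identify occurrences.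
  have h2 := congrArg Prod.snd h
  change X.2 = Y.2 at h2
  exact Prod.ext (Θ.index_unique X hX Y hY h2) h2

theorem mem_of_relabelOcc_mem {Θ : ProofStructure} (τ : Occ → Conn) {X : Occ} (hX : X ∈ Θ.forms)
    {s : Finset Occ} (hs : s ⊆ Θ.forms) (h : Θ.relabelOcc τ X ∈ s.image (Θ.relabelOcc τ)) :
    X ∈ s := by
  obtain ⟨Y, hY, e⟩ := Finset.mem_image.1 h
  exact Θ.relabelOcc_injOn τ (hs hY) hX e ▸ hY

/-- The proof structure `Θ` with the connectives changed as told by `τ`. -/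
noncomputable def relabel (Θ : ProofStructure) (τ : Occ → Conn) : ProofStructure where
  forms := Θ.forms.image (Θ.relabelOcc τ)
  links := Θ.links.image (Θ.relabelLink τ)
  premises_subset L hL := by
    obtain ⟨L, hL', rfl⟩ := Finset.mem_image.1 hL
    rw [relabelLink_premises]
    exact Finset.image_subset_image (Θ.premises_subset L hL')
  conclusions_subset L hL := by
    obtain ⟨L, hL', rfl⟩ := Finset.mem_image.1 hL
    rw [relabelLink_conclusions τ hL']
    exact Finset.image_subset_image (Θ.conclusions_subset L hL')
  index_unique X hX Y hY h := by
    obtain ⟨X, hX', rfl⟩ := Finset.mem_image.1 hX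
    obtain ⟨Y, hY', rfl⟩ := Finset.mem_image.1 hY
    have : X = Y := Prod.ext (Θ.index_unique X hX' Y hY' h) h
    rw [this]
  premise_unique X hX L hL L' hL' hXL hXL' := by
    obtain ⟨X, hX', rfl⟩ := Finset.mem_image.1 hX
    obtain ⟨L, hL₀, rfl⟩ := Finset.mem_image.1 hL
    obtain ⟨L', hL₀', rfl⟩ := Finset.mem_image.1 hL'
    rw [relabelLink_premises] at hXL hXL'
    rw [Θ.premise_unique X hX' L hL₀ L' hL₀'
      (mem_of_relabelOcc_mem τ hX' (Θ.premises_subset L hL₀) hXL)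
      (mem_of_relabelOcc_mem τ hX' (Θ.premises_subset L' hL₀') hXL')]
  premises_ne c X Y k h e := by
    obtain ⟨L, hL, e'⟩ := Finset.mem_image.1 h
    cases L with
    | ident i j => simp [relabelLink] at e'
    | mult d X' Y' k' =>
      have hsub := Θ.premises_subset _ hL
      simp only [relabelLink, Link.mult.injEq] at e'
      obtain ⟨-, rfl, rfl, -⟩ := e'
      exact Θ.premises_ne _ _ _ _ hL (Θ.relabelOcc_injOn τ (hsub (by simp [Link.premises]))
        (hsub (by simp [Link.premises])) e)
  conclusion_unique X hX := by
    obtain ⟨X, hX', rfl⟩ := Finset.mem_image.1 hX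
    obtain ⟨L, ⟨hL, hXL⟩, hu⟩ := Θ.conclusion_unique X hX'
    refine ⟨Θ.relabelLink τ L, ⟨Finset.mem_image_of_mem _ hL, ?_⟩, ?_⟩
    · rw [relabelLink_conclusions τ hL]
      exact Finset.mem_image_of_mem _ hXL
    · rintro M ⟨hM, hXM⟩
      obtain ⟨M, hM', rfl⟩ := Finset.mem_image.1 hM
      rw [relabelLink_conclusions τ hM'] at hXM
      rw [hu M ⟨hM', mem_of_relabelOcc_mem τ hX' (Θ.conclusions_subset M hM') hXM⟩]

theorem skel_relabel (Θ : ProofStructure) (τ : Occ → Conn) :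
    (Θ.relabel τ).skel = Θ.skel.image (Cell.map (Θ.relabelOcc τ)) := by
  unfold skel
  change (Θ.links.image (Θ.relabelLink τ)).image Link.toCell = _
  rw [Finset.image_image, Finset.image_image]
  exact Finset.image_congr fun L hL => toCell_relabelLink τ hL

/-- The graph of a proof structure does not depend on its connectives. -/
noncomputable def relabelIso (Θ : ProofStructure) (τ : Occ → Conn) :
    GraphIso Θ.graph (Θ.relabel τ).graph where
  hV := Equiv.ofBijective
    (fun X => ⟨Θ.relabelOcc τ X.1, Finset.mem_image_of_mem (Θ.relabelOcc τ) X.2⟩) <| by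
      constructor
      · rintro ⟨X, hX⟩ ⟨Y, hY⟩ e
        exact Subtype.ext (Θ.relabelOcc_injOn τ hX hY (congrArg Subtype.val e))
      · rintro ⟨Y, hY⟩
        obtain ⟨X, hX, rfl⟩ := Finset.mem_image.1 hY
        exact ⟨⟨X, hX⟩, rfl⟩
  hE := Equiv.ofBijective
    (fun e => ⟨(Θ.relabelOcc τ e.1.1, e.1.2.1, Θ.relabelOcc τ e.1.2.2), by
      obtain ⟨C, hC, he⟩ := (Θ.exists_edge_iff e.1).1 e.2
      refine (exists_edge_iff _ _).2 ⟨C.map (Θ.relabelOcc τ), ?_, ?_⟩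
      · rw [skel_relabel]
        exact Finset.mem_image_of_mem _ hC
      · rw [Cell.edges_map]
        exact Finset.mem_image_of_mem _ he⟩) <| by
      constructor
      · rintro ⟨⟨a, l, b⟩, h⟩ ⟨⟨a', l', b'⟩, h'⟩ e
        have e := congrArg Subtype.val e
        simp only [Prod.mk.injEq] at e
        obtain ⟨e1, rfl, e2⟩ := e
        have m := Θ.edge_mem_forms _ h
        have m' := Θ.edge_mem_forms _ h'
        have e1 := Θ.relabelOcc_injOn τ m.1 m'.1 e1
        have e2 := Θ.relabelOcc_injOn τ m.2 m'.2 e2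
        simp only at e1 e2
        subst e1 e2
        rfl
      · rintro ⟨e, h⟩
        obtain ⟨C, hC, he⟩ := (exists_edge_iff _ e).1 h
        rw [skel_relabel] at hC
        obtain ⟨C, hC', rfl⟩ := Finset.mem_image.1 hC
        rw [Cell.edges_map] at he
        obtain ⟨e, he', rfl⟩ := Finset.mem_image.1 he
        exact ⟨⟨e, (exists_edge_iff _ e).2 ⟨C, hC', he'⟩⟩, rfl⟩
  src_comm _ := rfl
  tgt_comm _ := rfl
  edgeLabel_comm _ := rfl

theorem mainConn_relabelIso {Θ : ProofStructure} (τ : Occ → Conn) {X : Occ}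
    (hX : IsNode Θ.skel X) : mainConn (occMap (Θ.relabelIso τ) X) = τ X := by
  rw [occMap_of_mem _ (vertices_skel Θ ▸ hX.mem_vertices)]
  change mainConn (Θ.relabelOcc τ X) = τ X
  obtain ⟨a, b, hX⟩ := hX
  obtain ⟨k, hL, e⟩ := exists_mult_link hX
  have := relabelOcc_multConcl τ hL
  rw [← e] at this
  rw [this, mainConn_multConcl]

theorem isProofNet_relabel_iff (Θ : ProofStructure) (τ : Occ → Conn) :
    (Θ.relabel τ).IsProofNet ↔ Seq τ Θ.skel := by
  rw [isProofNet_iff_of_iso (Θ.relabelIso τ)]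
  exact ⟨fun h => h.congr fun X hX => mainConn_relabelIso τ hX,
    fun h => h.congr fun X hX => (mainConn_relabelIso τ hX).symm⟩

theorem exists_iso_relabel (Θ : ProofStructure) (τ τ' : Occ → Conn) :
    ∃ h : GraphIso (Θ.relabel τ).graph (Θ.relabel τ').graph,
      mismatches h = Set.ncard {X : Occ | IsNode Θ.skel X ∧ τ X ≠ τ' X} := by
  refine ⟨(Θ.relabelIso τ).symm.trans (Θ.relabelIso τ'), ?_⟩
  rw [mismatches_symm_trans]
  congr 1
  ext X
  refine and_congr_right fun hX => ?_
  rw [mainConn_relabelIso τ hX, mainConn_relabelIso τ' hX]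

/-- Up to equality of proof structures, every member of the family of `Θ` is a relabelling of `Θ`;
labellings of one skeleton thus suffice. -/
theorem same_relabel {Θ Θ' : ProofStructure} (h : GraphIso Θ.graph Θ'.graph) :
    Θ'.Same (Θ.relabel fun X => mainConn (occMap h X)) := by
  refine same_of_mismatches_eq_zero (h.symm.trans (Θ.relabelIso _)) ?_
  rw [mismatches_symm_trans, Set.ncard_eq_zero (finite_isNode _ _)]
  refine Set.eq_empty_iff_forall_notMem.2 fun X hX => hX.2 ?_
  rw [mainConn_relabelIso _ hX.1]

/-- If two different proof nets share a graph, then some two different proof nets on this graph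
differ by exchanging the connectives of two vertices. -/
theorem exists_exchange {Θ Θ' : ProofStructure} (hΘ : Θ.IsProofNet) (hΘ' : Θ'.IsProofNet)
    (hr : Θ.Related Θ') (hne : ¬ Θ.Same Θ') :
    ∃ (τ τ' : Occ → Conn) (p q : Occ), Seq τ Θ.skel ∧ Seq τ' Θ.skel ∧
      ¬ (Θ.relabel τ).Same (Θ.relabel τ') ∧ p ≠ q ∧
      {X : Occ | IsNode Θ.skel X ∧ τ X ≠ τ' X} = {p, q} := by
  obtain ⟨h⟩ := hr
  have s1 := (isProofNet_iff_of_iso (GraphIso.refl Θ.graph)).1 hΘ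
  have s2 := (isProofNet_iff_of_iso h).1 hΘ'
  have chain := s2.chain s1
  have hns : ¬ (Θ.relabel fun X => mainConn (occMap (GraphIso.refl Θ.graph) X)).Same
      (Θ.relabel fun X => mainConn (occMap h X)) := fun hs =>
    hne (((same_relabel (GraphIso.refl Θ.graph)).trans hs).trans (same_relabel h).symm)
  -- If every step stayed within one class of equal structures, so would the whole chain, against
  -- `hns`.
  obtain ⟨τ, τ', ⟨hτ, hτ', p, q, hpq⟩, hsame⟩ :
      ∃ τ τ', Step Θ.skel τ τ' ∧ ¬ (Θ.relabel τ).Same (Θ.relabel τ') := by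
    by_contra hall
    push Not at hall
    have lift : ∀ {υ υ'}, Relation.ReflTransGen (Step Θ.skel) υ υ' →
        (Θ.relabel υ).Same (Θ.relabel υ') := by
      intro υ υ' hc
      induction hc with
      | refl => exact (same_relabel (Θ.relabelIso _)).trans (same_relabel (Θ.relabelIso _)).symm
      | tail _ hs ih => exact ih.trans (hall _ _ hs)
    exact hns (lift chain)
  obtain ⟨g, hg⟩ := Θ.exists_iso_relabel τ τ'
  have h0 : mismatches g ≠ 0 := fun e => hsame (same_of_mismatches_eq_zero g e)
  have h1 := mismatches_ne_one ((Θ.isProofNet_relabel_iff τ).2 hτ)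
    ((Θ.isProofNet_relabel_iff τ').2 hτ') g
  -- Closeness allows two differing nodes at most; zero would make the structures equal, and one is
  -- impossible for proof nets.
  have hle : {X : Occ | IsNode Θ.skel X ∧ τ X ≠ τ' X}.ncard ≤ 2 := by
    refine (Set.ncard_le_ncard (t := {p, q}) ?_ (Set.toFinite _)).trans
      ((Set.ncard_insert_le p {q}).trans (by simp))
    rintro X ⟨hX, hXne⟩
    by_contra hX'
    simp only [Set.mem_insert_iff, Set.mem_singleton_iff, not_or] at hX'
    exact hXne (hpq X hX hX'.1 hX'.2)
  rw [hg] at h0 h1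
  obtain ⟨p', q', hne', e⟩ := Set.ncard_eq_two.1
    (show {X : Occ | IsNode Θ.skel X ∧ τ X ≠ τ' X}.ncard = 2 by omega)
  exact ⟨τ, τ', p', q', hτ, hτ', hsame, hne', e⟩

end ProofStructure

/-! ### PS-families and the corollary -/

theorem IsPSFamily.related {F : Set ProofStructure} (hF : IsPSFamily F) {Θ Θ' : ProofStructure}
    (h : Θ ∈ F) (h' : Θ' ∈ F) : Θ.Related Θ' := by
  obtain ⟨Ψ, rfl⟩ := hF
  exact ProofStructure.relatedSetoid.trans h (ProofStructure.relatedSetoid.symm h')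

theorem IsPSFamily.mem {F : Set ProofStructure} (hF : IsPSFamily F) {Θ Θ' : ProofStructure}
    (h : Θ ∈ F) (h' : Θ.Related Θ') : Θ' ∈ F := by
  obtain ⟨Ψ, rfl⟩ := hF
  exact ProofStructure.relatedSetoid.trans (ProofStructure.relatedSetoid.symm h') h

end MLL

theorem mainTheorem2 (F : Set MLL.ProofStructure) (hF : MLL.IsPSFamily F)
    (htwo : ∃ Θ₁ ∈ F, ∃ Θ₂ ∈ F, Θ₁.IsProofNet ∧ Θ₂.IsProofNet ∧ ¬ Θ₁.Same Θ₂) :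
    IsLeast (MLL.netDistances F) 2 ∧ ¬ MLL.IsOneErrorCorrecting F := by
  obtain ⟨Θ, hΘF, Θ', hΘF', hΘ, hΘ', hne⟩ := htwo
  obtain ⟨τ, τ', p, q, hτ, hτ', hsame, hpq, hset⟩ :=
    MLL.ProofStructure.exists_exchange hΘ hΘ' (hF.related hΘF hΘF') hne
  have hmem : ∀ υ, Θ.relabel υ ∈ F := fun υ => hF.mem hΘF ⟨Θ.relabelIso υ⟩
  have hnet := (Θ.isProofNet_relabel_iff τ).2 hτ
  have hnet' := (Θ.isProofNet_relabel_iff τ').2 hτ'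
  refine ⟨⟨⟨_, hmem τ, _, hmem τ', hnet, hnet', hsame, ?_⟩, ?_⟩, ?_⟩
  · obtain ⟨g, hg⟩ := Θ.exists_iso_relabel τ τ'
    rw [hset, Set.ncard_pair hpq] at hg
    exact le_antisymm (hg ▸ MLL.ProofStructure.psDist_le g)
      (MLL.ProofStructure.two_le_psDist hnet hnet' (hF.related (hmem τ) (hmem τ')) hsame)
  · rintro n ⟨Θ₁, h₁, Θ₂, h₂, hn₁, hn₂, hs, rfl⟩
    exact MLL.ProofStructure.two_le_psDist hn₁ hn₂ (hF.related h₁ h₂) hs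
  · intro hcorr
    have hp : p ∈ {X : MLL.Occ | MLL.IsNode Θ.skel X ∧ τ X ≠ τ' X} := by rw [hset]; simp
    have hq : q ∈ {X : MLL.Occ | MLL.IsNode Θ.skel X ∧ τ X ≠ τ' X} := by rw [hset]; simp
    -- The halfway structure: only `p` has been changed, so it differs from the first net at `p` and
    -- from the second at `q`.
    obtain ⟨g, hg⟩ := Θ.exists_iso_relabel (Function.update τ p (τ' p)) τ
    obtain ⟨g', hg'⟩ := Θ.exists_iso_relabel (Function.update τ p (τ' p)) τ'
    have e : {X | MLL.IsNode Θ.skel X ∧ Function.update τ p (τ' p) X ≠ τ X} = {p} := by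
      ext X
      by_cases hX : X = p
      · subst hX
        simpa using ⟨hp.1, fun h => hp.2 h.symm⟩
      · simp [hX]
    have e' : {X | MLL.IsNode Θ.skel X ∧ Function.update τ p (τ' p) X ≠ τ' X} = {q} := by
      ext X
      by_cases hX : X = p
      · subst hX
        simpa using hpq
      · have := Set.ext_iff.1 hset X
        simp only [Set.mem_ofPred_eq, Set.mem_insert_iff, hX, false_or,
          Set.mem_singleton_iff] at this
        simp [hX, this]
    rw [e, Set.ncard_singleton] at hg
    rw [e', Set.ncard_singleton] at hg'
    have hd : MLL.psDist (Θ.relabel (Function.update τ p (τ' p))) (Θ.relabel τ) = 1 := by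
      refine le_antisymm (hg ▸ MLL.ProofStructure.psDist_le g)
        (Nat.one_le_iff_ne_zero.2 fun h0 => ?_)
      -- At distance zero the halfway structure would itself be a proof net, yet `g` changes exactly
      -- one of its labels on the way to a proof net.
      obtain ⟨f, hf⟩ := MLL.ProofStructure.exists_mismatches_eq_psDist ⟨g⟩
      exact MLL.ProofStructure.mismatches_ne_one
        (MLL.ProofStructure.isProofNet_of_mismatches_eq_zero f (hf.trans h0) hnet) hnet g hg
    have := hcorr _ (hmem _) _ (hmem τ) hnet hd _ (hmem τ') hnet' fun h => hsame h.symm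
    have := MLL.ProofStructure.psDist_le g'
    omega
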